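/- **Notation.** Let $\mathbb F_q$ be a finite field with $q$ elements, $A=\mathbb F_q[\theta]$, $k=\mathbb F_q(\theta)$. Let $v$ be a finite place of $k$ (a monic irreducible polynomial of $A$), $q_v=\#(A/vA)$, $k_v$ the completion of $k$ at $v$ with valuation ring $A_v$ and maximal ideal $\mathfrak m_v$, and $\mathrm{ord}_v$ the valuation with $\mathrm{ord}_v(v)=1$ and $\mathrm{ord}_v(0)=\infty$. An index is a tuple $\mathfrak s=(s_1,\dots,s_r)$ of positive integers with $r\ge 1$; put $\mathrm{wt}(\mathfrak s)=s_1+\dots+s_r$, $\mathrm{dep}(\mathfrak s)=r$, $\mathrm{ht}(\mathfrak s)=\#\{i: s_i\ne 1\}$. Let $[i]=\theta^{q^i}-\theta$, $D_0=1$, $D_i=\prod_{j=1}^{i}[j]^{q^{i-j}}$; for $n=\sum_j n_jq^j$ with $0\le n_j\le q-1$ let $\Gamma_{n+1}=\prod_j D_j^{n_j}$, and let $\Gamma_{\mathfrak s}=\Gamma_{s_1}\cdots\Gamma_{s_r}$. **Polylogarithms.** For an index $\mathfrak s$ and $\mathbf u=(u_1,\dots,u_r)\in A^r$ put $d_\ell=s_\ell+\dots+s_r$,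 $d=d_1+\dots+d_r$. Let $G_{\mathfrak s,\mathbf u}$ be the $d$-dimensional $t$-module with $\rho_t=\theta I_d+N+E\tau$ ($\tau$ the $q$-th power map), where $N=\mathrm{diag}(N_1,\dots,N_r)$, $N_\ell$ is the $d_\ell\times d_\ell$ matrix with ones on the superdiagonal and zeros elsewhere, and $E$ is block upper triangular, its $(\ell,m)$ block ($\ell\le m$, of size $d_\ell\times d_m$) having lower left entry $(-1)^{m-\ell}\prod_{e=\ell}^{m-1}u_e$ and zeros elsewhere. For $a\in\mathbb F_q[t]$ let $\rho_a$ be the image of $a$ under the $\mathbb F_q$-algebra homomorphism sending $t$ to $\rho_t$. Let $\mathbf v_{\mathfrak s,\mathbf u}\in A^d$ have $(-1)^{r-\ell}u_\ell\cdots u_r$ as the last entry of its $\ell$-th block (of length $d_\ell$) and zeros elsewhere. Let $\exp_G=\sum_{i\ge0}Q_i\tau^i$ be the unique series over $k$ with $Q_0=I_d$ and $\exp_G\circ(\theta I_d+N)=\rho_t\circ\exp_G$, and $\log_G=\sum_{i\ge 0}P_i\tau^i$ its formal inverse. With $\tilde{\mathfrak s}=(s_r,\dots,s_1)$, $\tilde{\mathbf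 u}=(u_r,\dots,u_1)$, $G=G_{\tilde{\mathfrak s},\tilde{\mathbf u}}$ and any $0\ne a(t)\in\mathbb F_q[t]$ such that all coordinates of $\rho_a(\mathbf v_{\tilde{\mathfrak s},\tilde{\mathbf u}})$ lie in $\mathfrak m_v$ (such $a$ exist), define $$\mathrm{Li}^\star_{\mathfrak s}(\mathbf u)_v=\frac{(-1)^{r-1}}{a(\theta)}\times\text{ the }(s_1+\dots+s_r)\text{-th coordinate of }\log_G\big(\rho_a(\mathbf v_{\tilde{\mathfrak s},\tilde{\mathbf u}})\big)\in k_v,$$ which does not depend on the choice of $a$. **$v$-adic multiple zeta values.** Let $F_0=1$, $F_i=\prod_{j=1}^{i}(t^{q^i}-\theta^{q^j})$, and define $H_n\in A[t]$ by $$\Big(1-\sum_{i\ge0}\frac{F_i}{D_i|_{\theta=t}}x^{q^i}\Big)^{-1}=\sum_{n\ge0}\frac{H_n}{\Gamma_{n+1}|_{\theta=t}}x^n .$$ Given $\mathfrak s$, write $H_{s_i-1}=\sum_{j=0}^{m_i}u_{ij}t^j$ with $u_{ij}\in A$, $m_i=\deg_t H_{s_i-1}$, and let $J_{\mathfrak s}=\prod_{i=1}^r\{0,\dots,m_i\}$.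 For $\mathbf j\in J_{\mathfrak s}$ put $\mathbf u_{\mathbf j}=(u_{1j_1},\dots,u_{rj_r})$. For $\mathbf w\in\{0,1\}^{r-1}$ let $\mathbf w(\mathfrak s)$ be obtained from $(s_1,\dots,s_r)$ by replacing the $i$-th comma by $+$ whenever $\mathbf w_i=1$, and let $\mathbf w^\times(\mathbf u_{\mathbf j})$ be obtained from $\mathbf u_{\mathbf j}$ by replacing the $i$-th comma by $\times$ whenever $\mathbf w_i=1$. Define $$\zeta_A(\mathfrak s)_v=\frac1{\Gamma_{\mathfrak s}}\sum_{\mathbf j\in J_{\mathfrak s}}\ \sum_{\mathbf w\in\{0,1\}^{r-1}}(-1)^{r-1}\theta^{j_1+\dots+j_r}(-1)^{\mathrm{dep}(\mathbf w(\mathfrak s))-1}\,\mathrm{Li}^\star_{\mathbf w(\mathfrak s)}(\mathbf w^\times(\mathbf u_{\mathbf j}))_v\in k_v .$$ **Theorem.** Let $\mathfrak s$ be an index. For every finite place $v$ of $k$, with $B_{w,v}=\min_{n\ge0}\{q_v^n-n\,w\}$, $$\mathrm{ord}_v(\zeta_A(\mathfrak s)_v)\ \ge\ B_{\mathrm{wt}(\mathfrak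 s),v}-\frac{\mathrm{wt}(\mathfrak s)-\mathrm{dep}(\mathfrak s)-\mathrm{ht}(\mathfrak s)}{q_v-1}.$$ In particular, $\zeta_A(\mathfrak s)_v\in A_v$ for every $v$ with $q_v\ge\mathrm{wt}(\mathfrak s)$, and hence $\zeta_A(\mathfrak s)_v\in A_v$ for all but finitely many $v$. -/

import Mathlib

open Polynomial IsDedekindDomain

namespace VadicMZV

noncomputable section

/-! ### The basic objects of the arithmetic of `A = 𝔽_q[θ]`

`F` is the finite field `𝔽_q`, `F[X]` is `A` (with `X = θ`), and `RatFunc F` is `k`.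
A finite place `v` of `k` is an element of `HeightOneSpectrum F[X]`. -/

section Carlitz

variable (F : Type*) [Field F] [Fintype F]

/-- `[i] = θ^{q^i} - θ`. -/
def bracket (i : ℕ) : F[X] := X ^ (Fintype.card F ^ i) - X

/-- `D_i = [i] [i-1]^q ⋯ [1]^{q^{i-1}}`, `D_0 = 1`. -/
def carlitzD (i : ℕ) : F[X] :=
  ∏ j ∈ Finset.range i, bracket F (j + 1) ^ (Fintype.card F ^ (i - 1 - j))

/-- `carlitzGammaSucc F n` is the Carlitz factorial `Γ_{n+1} = ∏_j D_j^{n_j}`, where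
`n = ∑_j n_j q^j` is the base `q` expansion, so `n_j = ⌊n / q^j⌋ mod q`
(and `n_j = 0` for `j > n`). -/
def carlitzGammaSucc (n : ℕ) : F[X] :=
  ∏ j ∈ Finset.range (n + 1), carlitzD F j ^ (n / Fintype.card F ^ j % Fintype.card F)

/-- `Γ_𝔰 = Γ_{s_1} ⋯ Γ_{s_r}` for an index of positive integers. -/
def carlitzGammaIndex {r : ℕ} (s : Fin r → ℕ) : F[X] := ∏ i, carlitzGammaSucc F (s i - 1)

lemma one_lt_q : 1 < Fintype.card F := Fintype.one_lt_card

lemma bracket_ne_zero (i : ℕ) : bracket F (i + 1) ≠ 0 :=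
  FiniteField.X_pow_card_pow_sub_X_ne_zero F (Nat.succ_ne_zero i) (one_lt_q F)

lemma carlitzD_ne_zero (i : ℕ) : carlitzD F i ≠ 0 :=
  Finset.prod_ne_zero_iff.2 fun _ _ => pow_ne_zero _ (bracket_ne_zero F _)

lemma carlitzGammaSucc_ne_zero (n : ℕ) : carlitzGammaSucc F n ≠ 0 :=
  Finset.prod_ne_zero_iff.2 fun _ _ => pow_ne_zero _ (carlitzD_ne_zero F _)

lemma carlitzD_succ (i : ℕ) :
    carlitzD F (i + 1) = bracket F (i + 1) * carlitzD F i ^ Fintype.card F := by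
  unfold carlitzD
  rw [Finset.prod_range_succ, ← Finset.prod_pow, mul_comm]
  congr 1
  · simp
  · refine Finset.prod_congr rfl fun j hj => ?_
    rw [← pow_mul, ← pow_succ]
    congr 2
    have := Finset.mem_range.1 hj
    omega

/-- The product defining the Carlitz factorial may be taken over any larger range. -/
lemma carlitzGammaSucc_eq {n m : ℕ} (h : n ≤ m) :
    carlitzGammaSucc F n =
      ∏ j ∈ Finset.range (m + 1), carlitzD F j ^ (n / Fintype.card F ^ j % Fintype.card F) := by
  unfold carlitzGammaSucc
  refine Finset.prod_subset (Finset.range_mono (by omega)) fun j _ hj => ?_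
  have hj' : n < j := by simpa using hj
  rw [Nat.div_eq_of_lt (hj'.trans (Nat.lt_pow_self (one_lt_q F)))]
  simp

/-- Carry argument behind the divisibility `D_i Γ_{m+1} ∣ Γ_{m+q^i+1}`. -/
lemma digit_prod_dvd {R : Type*} [CommRing R] {q : ℕ} (hq : 1 < q) (N : ℕ) :
    ∀ (D : ℕ → R), (∀ j, D j ^ q ∣ D (j + 1)) → ∀ i m : ℕ, m + q ^ i < q ^ N →
      D i * ∏ j ∈ Finset.range N, D j ^ (m / q ^ j % q) ∣
        ∏ j ∈ Finset.range N, D j ^ ((m + q ^ i) / q ^ j % q) := by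
  have hq0 : 0 < q := by omega
  induction N with
  | zero =>
    intro D _ i m h
    have : 0 < q ^ i := by positivity
    simp at h
    omega
  | succ N ih =>
    intro D hD i m h
    have key : ∀ n, ∏ j ∈ Finset.range (N + 1), D j ^ (n / q ^ j % q) =
        (∏ j ∈ Finset.range N, D (j + 1) ^ (n / q / q ^ j % q)) * D 0 ^ (n % q) := by
      intro n
      rw [Finset.prod_range_succ']
      simp [Nat.div_div_eq_div_mul, pow_succ']
    rw [key, key]
    have ih' := ih (fun j => D (j + 1)) (fun j => hD (j + 1))
    cases i with
    | succ k =>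
      have h1 : (m + q ^ (k + 1)) / q = m / q + q ^ k := by
        rw [pow_succ, Nat.add_mul_div_right _ _ hq0]
      have h2 : (m + q ^ (k + 1)) % q = m % q := by
        rw [pow_succ, Nat.add_mul_mod_self_right]
      rw [h1, h2, ← mul_assoc]
      refine mul_dvd_mul_right (ih' k (m / q) ?_) _
      rw [← h1]
      exact Nat.div_lt_of_lt_mul (by rw [← pow_succ']; exact h)
    | zero =>
      have hm := Nat.div_add_mod m q
      have hlt := Nat.mod_lt m hq0
      by_cases hc : m % q + 1 < q
      · have h1 : (m + q ^ 0) / q = m / q := by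
          rw [pow_zero]
          conv_lhs => rw [← hm, add_assoc, Nat.mul_add_div hq0, Nat.div_eq_of_lt hc, add_zero]
        have h2 : (m + q ^ 0) % q = m % q + 1 := by
          rw [pow_zero, Nat.add_mod, Nat.mod_eq_of_lt hq, Nat.mod_eq_of_lt hc]
        rw [h1, h2, pow_succ]
        exact dvd_of_eq (by ring)
      · have hc' : m % q = q - 1 := by omega
        have h0 : m + q ^ 0 = q * (m / q + 1) := by
          rw [pow_zero, mul_add]
          omega
        have h1 : (m + q ^ 0) / q = m / q + q ^ 0 := by
          rw [h0, Nat.mul_div_cancel_left _ hq0, pow_zero]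
        have h2 : (m + q ^ 0) % q = 0 := by rw [h0, Nat.mul_mod_right]
        have h3 : m / q + q ^ 0 < q ^ N := by
          rw [← h1]
          exact Nat.div_lt_of_lt_mul (by rw [← pow_succ']; exact h)
        rw [h1, h2, hc', pow_zero (D 0), mul_one]
        refine dvd_trans ?_ (ih' 0 (m / q) h3)
        have h4 : D 0 * ((∏ j ∈ Finset.range N, D (j + 1) ^ (m / q / q ^ j % q)) *
            D 0 ^ (q - 1)) =
            D 0 ^ q * ∏ j ∈ Finset.range N, D (j + 1) ^ (m / q / q ^ j % q) := by
          obtain ⟨p, rfl⟩ : ∃ p, q = p + 1 := ⟨q - 1, by omega⟩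
          simp only [Nat.add_sub_cancel]
          ring
        rw [h4]
        exact mul_dvd_mul_right (hD 0) _

lemma carlitzD_mul_gamma_dvd (i m : ℕ) :
    carlitzD F i * carlitzGammaSucc F m ∣ carlitzGammaSucc F (m + Fintype.card F ^ i) := by
  rw [carlitzGammaSucc_eq F (le_refl (m + Fintype.card F ^ i)),
    carlitzGammaSucc_eq F (Nat.le_add_right m (Fintype.card F ^ i))]
  refine digit_prod_dvd (one_lt_q F) _ (carlitzD F)
    (fun j => ⟨bracket F (j + 1), by rw [carlitzD_succ, mul_comm]⟩) i m ?_
  exact (Nat.lt_succ_self _).trans (Nat.lt_pow_self (one_lt_q F))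

end Carlitz

/-! ### Anderson-Thakur polynomials

Elements of `A[t]` are polynomials over `F[X]`: the outer variable is `t`, and `C X` is `θ`. -/

section AndersonThakur

/-- The specialization `f(θ) ↦ f|_{θ = t}` from `𝔽_q[θ]` to `𝔽_q[t] ⊆ A[t]`. -/
def thetaToT (F : Type*) [Field F] (f : F[X]) : F[X][X] := f.map C

lemma thetaToT_ne_zero (F : Type*) [Field F] {f : F[X]} (hf : f ≠ 0) :
    algebraMap F[X][X] (FractionRing F[X][X]) (thetaToT F f) ≠ 0 := by
  rw [Ne, FaithfulSMul.algebraMap_eq_zero_iff, thetaToT,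
    Polynomial.map_eq_zero_iff (C_injective)]
  exact hf

variable (F : Type*) [Field F] [Fintype F]

/-- `F_i = ∏_{j=1}^{i} (t^{q^i} - θ^{q^j})`, `F_0 = 1`. -/
def atF (i : ℕ) : F[X][X] :=
  ∏ j ∈ Finset.range i, (X ^ (Fintype.card F ^ i) - C (X ^ (Fintype.card F ^ (j + 1))))

/-- The series `∑_{i ≥ 0} (F_i / D_i|_{θ = t}) x^{q^i}` with coefficients in `Frac(A[t])`. -/
def atSeries : PowerSeries (FractionRing F[X][X]) :=
  PowerSeries.mk fun m => ∑ i ∈ Finset.range (m + 1),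
    if m = Fintype.card F ^ i then
      algebraMap F[X][X] (FractionRing F[X][X]) (atF F i) /
        algebraMap F[X][X] (FractionRing F[X][X]) (thetaToT F (carlitzD F i))
    else 0

/-- The coefficients of `(1 - ∑ (F_i / D_i|_{θ=t}) x^{q^i})⁻¹`, multiplied by `Γ_{n+1}|_{θ=t}`,
are polynomials. -/
lemma exists_andersonThakur (n : ℕ) : ∃ H : F[X][X],
    PowerSeries.coeff n (1 - atSeries F)⁻¹ =
      algebraMap F[X][X] (FractionRing F[X][X]) H /
        algebraMap F[X][X] (FractionRing F[X][X]) (thetaToT F (carlitzGammaSucc F n)) := by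
  have h0 : PowerSeries.constantCoeff (1 - atSeries F) ≠ 0 := by
    rw [map_sub, map_one, ← PowerSeries.coeff_zero_eq_constantCoeff_apply, atSeries,
      PowerSeries.coeff_mk, Finset.sum_eq_zero]
    · simp
    · intro i _
      rw [if_neg]
      exact (pow_pos Fintype.card_pos i).ne
  have hrec : (1 - atSeries F)⁻¹ = 1 + atSeries F * (1 - atSeries F)⁻¹ := by
    have := PowerSeries.mul_inv_cancel _ h0
    rw [sub_mul, one_mul] at this
    exact sub_eq_iff_eq_add.1 this
  induction n using Nat.strong_induction_on with
  | _ n ih =>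
  have hG := thetaToT_ne_zero F (carlitzGammaSucc_ne_zero F n)
  suffices h : algebraMap F[X][X] (FractionRing F[X][X])
      (thetaToT F (carlitzGammaSucc F n)) * PowerSeries.coeff n (1 - atSeries F)⁻¹ ∈
        (algebraMap F[X][X] (FractionRing F[X][X])).range by
    obtain ⟨H, hH⟩ := h
    exact ⟨H, by rw [hH, mul_div_cancel_left₀ _ hG]⟩
  rw [hrec, map_add, mul_add, PowerSeries.coeff_mul, Finset.mul_sum]
  refine Subring.add_mem _ ?_ (Subring.sum_mem _ fun ab hab => ?_)
  · rw [PowerSeries.coeff_one]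
    split_ifs
    · exact ⟨_, (mul_one _).symm⟩
    · rw [mul_zero]
      exact Subring.zero_mem _
  · obtain ⟨a, b⟩ := ab
    have hab' : a + b = n := Finset.HasAntidiagonal.mem_antidiagonal.1 hab
    dsimp only
    rw [atSeries, PowerSeries.coeff_mk, Finset.sum_mul, Finset.mul_sum]
    refine Subring.sum_mem _ fun i _ => ?_
    split_ifs with hi
    · have hpos : 0 < Fintype.card F ^ i := pow_pos Fintype.card_pos i
      obtain ⟨H, hH⟩ := ih b (by omega)
      rw [show (1 - PowerSeries.mk _ : PowerSeries (FractionRing F[X][X])) = 1 - atSeries F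
        from rfl, hH]
      obtain ⟨c, hc⟩ := carlitzD_mul_gamma_dvd F i b
      have hn : n = b + Fintype.card F ^ i := by omega
      have hD := thetaToT_ne_zero F (carlitzD_ne_zero F i)
      have hb := thetaToT_ne_zero F (carlitzGammaSucc_ne_zero F b)
      refine ⟨thetaToT F c * atF F i * H, ?_⟩
      rw [hn, hc]
      have hmul : thetaToT F (carlitzD F i * carlitzGammaSucc F b * c) =
          thetaToT F (carlitzD F i) * thetaToT F (carlitzGammaSucc F b) * thetaToT F c := by
        simp [thetaToT, Polynomial.map_mul]
      rw [hmul]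
      simp only [map_mul]
      field_simp
    · rw [zero_mul, mul_zero]
      exact Subring.zero_mem _

/-- The Anderson-Thakur polynomial `H_n ∈ A[t]`, determined by
`(1 - ∑_i (F_i / D_i|_{θ=t}) x^{q^i})⁻¹ = ∑_n (H_n / Γ_{n+1}|_{θ=t}) x^n`. -/
def andersonThakur (n : ℕ) : F[X][X] := (exists_andersonThakur F n).choose

end AndersonThakur

/-! ### The `t`-module `G_{𝔰,𝐮}` -/

section TModule

/-- `d_ℓ = s_ℓ + ⋯ + s_r`. -/
def blockDim {r : ℕ} (s : Fin r → ℕ) (l : Fin r) : ℕ := ∑ e ∈ Finset.Ici l, s e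

/-- The `d = d_1 + ⋯ + d_r` coordinates, arranged in `r` blocks: `⟨ℓ, j⟩` is the `(j+1)`-st
coordinate of the block of size `d_ℓ`. -/
abbrev Coord {r : ℕ} (s : Fin r → ℕ) : Type := Σ l : Fin r, Fin (blockDim s l)

/-- The matrix `N = diag(N_1, …, N_r)`, each `N_ℓ` having ones on the superdiagonal. -/
def matN (R : Type*) [CommRing R] {r : ℕ} (s : Fin r → ℕ) : Matrix (Coord s) (Coord s) R :=
  fun p p' => if p.1 = p'.1 ∧ (p.2 : ℕ) + 1 = p'.2 then 1 else 0

/-- The matrix `E = (E[ℓ m])`: for `ℓ ≤ m` the lower left corner of the block `E[ℓ m]` is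
`(-1)^{m-ℓ} ∏_{e=ℓ}^{m-1} u_e`, and all other entries vanish. -/
def matE {R : Type*} [CommRing R] {r : ℕ} (s : Fin r → ℕ) (u : Fin r → R) :
    Matrix (Coord s) (Coord s) R :=
  fun p p' =>
    if p.1 ≤ p'.1 ∧ (p.2 : ℕ) + 1 = blockDim s p.1 ∧ (p'.2 : ℕ) = 0 then
      (-1) ^ ((p'.1 : ℕ) - p.1) * ∏ e ∈ Finset.Ico p.1 p'.1, u e
    else 0

/-- The special point `𝐯_{𝔰,𝐮}`: the last coordinate of the `ℓ`-th block is
`(-1)^{r-ℓ} u_ℓ ⋯ u_r`, all other coordinates vanish. -/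
def specialPoint {R : Type*} [CommRing R] {r : ℕ} (s : Fin r → ℕ) (u : Fin r → R) : Coord s → R :=
  fun p => if (p.2 : ℕ) + 1 = blockDim s p.1 then
    (-1) ^ (r - 1 - (p.1 : ℕ)) * ∏ e ∈ Finset.Ici p.1, u e else 0

variable {F : Type*} [Field F] [Fintype F]

/-- `ρ_t = θ I_d + N + E τ` acting on the `A`-valued points of `G_{𝔰,𝐮}`, for `𝐮 ∈ A^r`. -/
def rhoT {r : ℕ} (s : Fin r → ℕ) (u : Fin r → F[X]) : Module.End F (Coord s → F[X]) where
  toFun x := (X : F[X]) • x + (matN F[X] s).mulVec x +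
    (matE s u).mulVec fun p => x p ^ Fintype.card F
  map_add' x y := by
    have h : (fun p => (x + y) p ^ Fintype.card F) =
        (fun p => x p ^ Fintype.card F) + fun p => y p ^ Fintype.card F :=
      funext fun p => map_add (FiniteField.frobeniusAlgHom F F[X]) (x p) (y p)
    rw [h, smul_add, Matrix.mulVec_add, Matrix.mulVec_add]
    abel
  map_smul' c x := by
    have h : (fun p => (c • x) p ^ Fintype.card F) = c • fun p => x p ^ Fintype.card F :=
      funext fun p => map_smul (FiniteField.frobeniusAlgHom F F[X]) c (x p)
    rw [h, Matrix.mulVec_smul, Matrix.mulVec_smul, RingHom.id_apply, smul_add, smul_add,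
      smul_comm c (X : F[X]) x]

/-- The `𝔽_q`-linear ring homomorphism `a ↦ ρ_a` from `𝔽_q[t]`, on `A`-valued points. Here
`𝔽_q[t]` is again represented by `F[X]`, with `X = t`. -/
def rho {r : ℕ} (s : Fin r → ℕ) (u : Fin r → F[X]) : F[X] →ₐ[F] Module.End F (Coord s → F[X]) :=
  Polynomial.aeval (rhoT s u)

end TModule

/-! ### Exponential and logarithm of `G_{𝔰,𝐮}` -/

section ExpLog

variable {K ι : Type*} [Field K] [Fintype ι] [DecidableEq ι]

/-- A power series `∑ P_i τ^i` with matrix coefficients is given by the sequence `P`. This is the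
product of such series, with the rule `τ M = M^{(1)} τ`, where `M^{(i)}` has the entries of `M`
raised to the power `q^i`. -/
def twMul (q : ℕ) (P Q : ℕ → Matrix ι ι K) : ℕ → Matrix ι ι K :=
  fun n => ∑ i ∈ Finset.range (n + 1), P i * (Q (n - i)).map (· ^ q ^ i)

/-- The series `M τ^0`. -/
def twConst (M : Matrix ι ι K) : ℕ → Matrix ι ι K := fun n => if n = 0 then M else 0

/-- The series `M_0 + M_1 τ`. -/
def twLinear (M₀ M₁ : Matrix ι ι K) : ℕ → Matrix ι ι K :=
  fun n => if n = 0 then M₀ else if n = 1 then M₁ else 0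

/-- The left inverse, in the ring of twisted power series, of a series with constant term `1`
(see `twMul_twInv`). -/
def twInv (q : ℕ) (Q : ℕ → Matrix ι ι K) : ℕ → Matrix ι ι K
  | 0 => 1
  | n + 1 => -∑ i : Fin (n + 1), twInv q Q i * (Q (n + 1 - i)).map (· ^ q ^ (i : ℕ))
termination_by n => n
decreasing_by exact i.2

lemma twMul_twInv (q : ℕ) (Q : ℕ → Matrix ι ι K) (hQ : Q 0 = 1) (hq : q ≠ 0) :
    twMul q (twInv q Q) Q = twConst 1 := by
  have h1 : ∀ i, (1 : Matrix ι ι K).map (· ^ q ^ i) = 1 := fun i =>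
    Matrix.map_one _ (zero_pow (pow_ne_zero _ hq)) (one_pow _)
  funext n
  cases n with
  | zero => simp [twMul, twConst, twInv, hQ]
  | succ n =>
    simp only [twMul, twConst]
    rw [Finset.sum_range_succ]
    simp only [Nat.sub_self, hQ, h1, mul_one]
    rw [twInv, Finset.sum_range]
    simp

/-- The defining properties of the exponential of a `t`-module with `ρ_t = M₀ + E τ`, so
`∂ρ_t = M₀`: it is `∑ Q_i τ^i` with `Q_0 = I` and `exp ∘ ∂ρ_t = ρ_t ∘ exp`. Since `t` generates
`𝔽_q[t]`, this is the same as `exp ∘ ∂ρ_a = ρ_a ∘ exp` for all `a`. -/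
def IsExp (q : ℕ) (M₀ E : Matrix ι ι K) (Q : ℕ → Matrix ι ι K) : Prop :=
  Q 0 = 1 ∧ twMul q Q (twConst M₀) = twMul q (twLinear M₀ E) Q

lemma existsUnique_isExp {q : ℕ} {θ : K} (hθ : ∀ n, θ ^ q ^ (n + 1) ≠ θ)
    {N E : Matrix ι ι K} (hN : IsNilpotent N)
    (hmap : ∀ i, (θ • (1 : Matrix ι ι K) + N).map (· ^ q ^ i) = θ ^ q ^ i • 1 + N) (hq : q ≠ 0) :
    ∃! Q : ℕ → Matrix ι ι K, IsExp q (θ • 1 + N) E Q := by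
  let S : ℕ → Module.End K (Matrix ι ι K) := fun n =>
    (θ ^ q ^ (n + 1) - θ) • 1 + (LinearMap.mulRight K N - LinearMap.mulLeft K N)
  have hS : ∀ n, IsUnit (S n) := by
    intro n
    have hnil : IsNilpotent (LinearMap.mulRight K N - LinearMap.mulLeft K N) := by
      refine Commute.isNilpotent_sub (LinearMap.commute_mulLeft_right (R := K) N N).symm ?_ ?_
      · obtain ⟨k, hk⟩ := hN
        exact ⟨k, by rw [LinearMap.pow_mulRight, hk, LinearMap.mulRight_zero_eq_zero]⟩
      · obtain ⟨k, hk⟩ := hN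
        exact ⟨k, by rw [LinearMap.pow_mulLeft, hk, LinearMap.mulLeft_zero_eq_zero]⟩
    have hu : IsUnit ((θ ^ q ^ (n + 1) - θ) • (1 : Module.End K (Matrix ι ι K))) := by
      rw [← Algebra.algebraMap_eq_smul_one]
      exact (IsUnit.mk0 _ (sub_ne_zero.2 (hθ n))).map (algebraMap K _)
    refine IsNilpotent.isUnit_add_left_of_commute hnil hu ?_
    exact (Commute.one_right _).smul_right _
  have hS' : ∀ n, Function.Bijective (S n) := fun n => (Module.End.isUnit_iff _).1 (hS n)
  have hSapp : ∀ n M, S n M = M * (θ ^ q ^ (n + 1) • 1 + N) - (θ • 1 + N) * M := by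
    intro n M
    simp only [S, LinearMap.add_apply, LinearMap.smul_apply, LinearMap.sub_apply,
      Module.End.one_apply, LinearMap.mulRight_apply, LinearMap.mulLeft_apply, mul_add, add_mul,
      mul_smul_comm, smul_mul_assoc, mul_one, one_mul, sub_smul]
    abel
  have hz : ∀ i, (0 : Matrix ι ι K).map (· ^ q ^ i) = 0 := fun i =>
    Matrix.map_zero _ (zero_pow (pow_ne_zero _ hq))
  have hexp : ∀ Q : ℕ → Matrix ι ι K, IsExp q (θ • 1 + N) E Q ↔
      Q 0 = 1 ∧ ∀ n, S n (Q (n + 1)) = E * (Q n).map (· ^ q ^ 1) := by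
    intro Q
    refine and_congr_right fun h0 => ?_
    have hl : ∀ n, twMul q Q (twConst (θ • 1 + N)) n = Q n * (θ ^ q ^ n • 1 + N) := by
      intro n
      simp only [twMul, twConst]
      rw [Finset.sum_range_succ, Finset.sum_eq_zero, zero_add, Nat.sub_self, if_pos rfl, hmap]
      intro i hi
      rw [if_neg (by have := Finset.mem_range.1 hi; omega), hz, mul_zero]
    have hr : ∀ n, twMul q (twLinear (θ • 1 + N) E) Q (n + 1) =
        (θ • 1 + N) * Q (n + 1) + E * (Q n).map (· ^ q ^ 1) := by
      intro n
      simp only [twMul, twLinear]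
      rw [Finset.sum_range_succ', Finset.sum_range_succ', Finset.sum_eq_zero]
      · simp [add_comm]
      · intro i _
        rw [if_neg (by omega), if_neg (by omega), zero_mul]
    constructor
    · intro h n
      rw [hSapp, ← hl, h, hr]
      abel
    · intro h
      funext n
      cases n with
      | zero =>
        rw [hl]
        simp [twMul, twLinear, h0]
      | succ n =>
        rw [hl, hr, ← h, hSapp]
        abel
  let Q₀ : ℕ → Matrix ι ι K := fun n => Nat.rec 1
    (fun n M => Function.surjInv (hS' n).2 (E * M.map (· ^ q ^ 1))) n
  refine ⟨Q₀, (hexp _).2 ⟨rfl, fun n => Function.surjInv_eq (hS' n).2 _⟩, fun Q hQ => ?_⟩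
  obtain ⟨h0, h1⟩ := (hexp Q).1 hQ
  funext n
  induction n with
  | zero => exact h0
  | succ n ih =>
    refine (hS' n).1 ?_
    rw [h1, ih]
    exact (Function.surjInv_eq (hS' n).2 _).symm

lemma isNilpotent_matN (R : Type*) [CommRing R] {r : ℕ} (s : Fin r → ℕ) :
    IsNilpotent (matN R s) := by
  have key : ∀ k, ∀ p p' : Coord s, (p.2 : ℕ) + k ≠ p'.2 → (matN R s ^ k) p p' = 0 := by
    intro k
    induction k with
    | zero =>
      intro p p' h
      rw [pow_zero, Matrix.one_apply_ne]
      rintro rfl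
      exact h rfl
    | succ k ih =>
      intro p p' h
      rw [pow_succ', Matrix.mul_apply]
      refine Finset.sum_eq_zero fun p'' _ => ?_
      by_cases hp : p.1 = p''.1 ∧ (p.2 : ℕ) + 1 = p''.2
      · rw [ih p'' p' (by omega), mul_zero]
      · rw [matN, if_neg hp, zero_mul]
  refine ⟨∑ l, blockDim s l, ?_⟩
  ext p p'
  refine key _ p p' ?_
  have h1 := p'.2.2
  have h2 : blockDim s p'.1 ≤ ∑ l, blockDim s l :=
    Finset.single_le_sum (fun _ _ => Nat.zero_le _) (Finset.mem_univ p'.1)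
  omega

variable (F : Type*) [Field F] [Fintype F]

/-- Existence and uniqueness of the exponential series of `G_{𝔰,𝐮}`. -/
lemma existsUnique_expCoeff {r : ℕ} (s : Fin r → ℕ) (u : Fin r → F[X]) :
    ∃! Q : ℕ → Matrix (Coord s) (Coord s) (RatFunc F),
      IsExp (Fintype.card F) ((RatFunc.X : RatFunc F) • 1 + matN (RatFunc F) s)
        (matE s fun i => algebraMap F[X] (RatFunc F) (u i)) Q := by
  have hq : Fintype.card F ≠ 0 := Fintype.card_ne_zero
  refine existsUnique_isExp (fun n h => ?_) ?_ (fun i => ?_) hq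
  · refine bracket_ne_zero F n ?_
    apply RatFunc.algebraMap_injective F
    simpa [bracket, sub_eq_zero] using h
  · exact isNilpotent_matN _ s
  · ext p p'
    have h0 : (0 : RatFunc F) ^ Fintype.card F ^ i = 0 := zero_pow (pow_ne_zero _ hq)
    by_cases hp : p = p'
    · subst hp
      simp [matN]
    · simp only [Matrix.map_apply, Matrix.add_apply, Matrix.smul_apply, Matrix.one_apply_ne hp,
        smul_zero, zero_add, matN]
      split_ifs
      · exact one_pow _
      · exact h0

/-- The coefficients `Q_i`, with entries in `k`, of `exp_G = ∑ Q_i τ^i` for `G = G_{𝔰,𝐮}`. -/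
def expCoeff {r : ℕ} (s : Fin r → ℕ) (u : Fin r → F[X]) :
    ℕ → Matrix (Coord s) (Coord s) (RatFunc F) :=
  (existsUnique_expCoeff F s u).choose

/-- The coefficients `P_i`, with entries in `k`, of `log_G = ∑ P_i τ^i` for `G = G_{𝔰,𝐮}`: the
formal inverse of the exponential. -/
def logCoeff {r : ℕ} (s : Fin r → ℕ) (u : Fin r → F[X]) :
    ℕ → Matrix (Coord s) (Coord s) (RatFunc F) :=
  twInv (Fintype.card F) (expCoeff F s u)

end ExpLog

/-! ### `v`-adic Carlitz multiple star polylogarithms -/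

section StarLog

variable {F : Type*} [Field F] [Fintype F] (v : HeightOneSpectrum F[X])

/-- The value `log_G(x) = ∑_i P_i x^{(i)}` for `G = G_{𝔰,𝐮}` and `x` with coordinates in `k_v`
(used only where the series converges). -/
def logG {r : ℕ} (s : Fin r → ℕ) (u : Fin r → F[X]) (x : Coord s → v.adicCompletion (RatFunc F)) :
    Coord s → v.adicCompletion (RatFunc F) :=
  fun p => ∑' i : ℕ, ∑ p', algebraMap (RatFunc F) (v.adicCompletion (RatFunc F))
    (logCoeff F s u i p p') * x p' ^ Fintype.card F ^ i

/-- `a ∈ 𝔽_q[t]` is nonzero and `ρ_a(𝐯_{𝔰,𝐮})` has all its coordinates in the maximal ideal. -/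
def IsAdmissible {r : ℕ} (s : Fin r → ℕ) (u : Fin r → F[X]) (a : F[X]) : Prop :=
  a ≠ 0 ∧ ∀ p, Valued.v (algebraMap F[X] (v.adicCompletion (RatFunc F))
    (rho s u a (specialPoint s u) p)) < 1

lemma finite_residue : Finite (F[X] ⧸ v.asIdeal) := by
  obtain ⟨f, hf⟩ := IsPrincipalIdealRing.principal v.asIdeal
  have hf0 : f ≠ 0 := by
    rintro rfl
    exact v.ne_bot (by simpa using hf)
  have hfin : Module.Finite F (AdjoinRoot f) := (AdjoinRoot.powerBasis hf0).finite
  have : Finite (AdjoinRoot f) := Module.finite_of_finite F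
  rw [hf]
  exact this

lemma exists_isAdmissible {r : ℕ} (s : Fin r → ℕ) (u : Fin r → F[X]) :
    ∃ a, IsAdmissible v s u a := by
  have := finite_residue v
  let Φ : F[X] → Coord s → F[X] ⧸ v.asIdeal := fun a p =>
    Ideal.Quotient.mk v.asIdeal (rho s u a (specialPoint s u) p)
  have hΦ : ¬ Function.Injective Φ := not_injective_infinite_finite Φ
  obtain ⟨a, b, hab, hne⟩ : ∃ a b, Φ a = Φ b ∧ a ≠ b := by
    simpa [Function.Injective] using hΦ
  refine ⟨a - b, sub_ne_zero.2 hne, fun p => ?_⟩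
  have h := Ideal.Quotient.eq.1 (congrFun hab p)
  rw [map_sub, LinearMap.sub_apply, Pi.sub_apply]
  exact (HeightOneSpectrum.valuedAdicCompletion_eq_valuation v _).trans_lt
    ((HeightOneSpectrum.valuation_lt_one_iff_mem v _).2 h)

/-- The `v`-adic Carlitz multiple star polylogarithm `Li⋆_𝔰(𝐮)_v` for `𝐮 ∈ A^r`. With
`𝔰~ = (s_r, …, s_1)`, `𝐮~ = (u_r, …, u_1)`, it is `(-1)^{r-1} / a(θ)` times the `d~_1`-th
coordinate (the last one of the first block) of `log_G(ρ_a(𝐯))`, where `G = G_{𝔰~,𝐮~}`,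
`𝐯 = 𝐯_{𝔰~,𝐮~}`, and `a` is any nonzero polynomial with `ρ_a(𝐯) ∈ G(𝔪_v)`; the value does not
depend on `a`. The sum below has exactly one term. -/
def starLi {r : ℕ} (s : Fin r → ℕ) (u : Fin r → F[X]) : v.adicCompletion (RatFunc F) :=
  let s' := s ∘ Fin.rev
  let u' := u ∘ Fin.rev
  let a : F[X] := (exists_isAdmissible v s' u').choose
  (-1) ^ (r - 1) / algebraMap F[X] (v.adicCompletion (RatFunc F)) a *
    ∑ p : Coord s' with (p.1 : ℕ) = 0 ∧ (p.2 : ℕ) + 1 = blockDim s' p.1,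
      logG v s' u' (fun p' => algebraMap F[X] (v.adicCompletion (RatFunc F))
        (rho s' u' a (specialPoint s' u') p')) p

end StarLog

/-! ### `v`-adic multiple zeta values -/

section MZV

/-- For a sequence of signs `𝐰` (`false` is a comma, `true` merges two neighbours) and a list of
pairs `(s_1,u_1), …, (s_r,u_r)`, the list of pairs formed by the entries of `𝐰(𝔰)` and
`𝐰^×(𝐮)`: merging adds the first components and multiplies the second ones. -/
def merge {R : Type*} [Mul R] : List Bool → List (ℕ × R) → List (ℕ × R)
  | false :: w, x :: l => x :: merge w l
  | true :: w, x :: y :: l => merge w ((x.1 + y.1, x.2 * y.2) :: l)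
  | _, l => l

variable {F : Type*} [Field F] [Fintype F] (v : HeightOneSpectrum F[X])

/-- The `v`-adic multiple zeta value
`ζ_A(𝔰)_v = Γ_𝔰⁻¹ ∑_{𝐣 ∈ J_𝔰} ∑_{𝐰 ∈ {0,1}^{r-1}} b · (-1)^{dep(𝐰(𝔰)) - 1} Li⋆_{𝐰(𝔰)}(𝐰^×(𝐮_𝐣))_v`
with `b = (-1)^{r-1} θ^{j_1 + ⋯ + j_r}` and `𝐮_𝐣 = (u_{1 j_1}, …, u_{r j_r})`, `u_{ij}` being the
coefficient of `t^j` in `H_{s_i - 1}`, and `J_𝔰 = ∏_i {0, …, m_i}`, `m_i = deg_t H_{s_i - 1}`. -/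
def vadicMZV {r : ℕ} (s : Fin r → ℕ) : v.adicCompletion (RatFunc F) :=
  (algebraMap F[X] (v.adicCompletion (RatFunc F)) (carlitzGammaIndex F s))⁻¹ *
    ∑ j ∈ Fintype.piFinset fun i => Finset.range ((andersonThakur F (s i - 1)).natDegree + 1),
      ∑ w : Fin (r - 1) → Bool,
        let L : List (ℕ × F[X]) := merge (List.ofFn w)
          (List.ofFn fun i => (s i, (andersonThakur F (s i - 1)).coeff (j i)))
        algebraMap F[X] (v.adicCompletion (RatFunc F)) ((-1) ^ (r - 1) * X ^ (∑ i, j i)) *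
          (-1) ^ (L.length - 1) * starLi v (fun i => (L.get i).1) (fun i => (L.get i).2)

/-- `wt(𝔰) = s_1 + ⋯ + s_r`. -/
def weight {r : ℕ} (s : Fin r → ℕ) : ℕ := ∑ i, s i

/-- `ht(𝔰)` is the number of `i` with `s_i ≠ 1`. -/
def height {r : ℕ} (s : Fin r → ℕ) : ℕ := Finset.card {i | s i ≠ 1}

/-- `q_v`, the cardinality of the residue field `A / vA`. -/
def qv : ℕ := Nat.card (F[X] ⧸ v.asIdeal)

/-- `B_{w,v} = min_{n ≥ 0} (q_v^n - n w)`; the minimum exists, see `isLeast_boundB`. -/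
def boundB (w : ℕ) : ℤ := ⨅ n : ℕ, ((qv v : ℤ) ^ n - n * w)

lemma isLeast_boundB (w : ℕ) :
    IsLeast (Set.range fun n : ℕ => (qv v : ℤ) ^ n - n * w) (boundB v w) := by
  have hfin := finite_residue v
  have hnt : Nontrivial (F[X] ⧸ v.asIdeal) := Ideal.Quotient.nontrivial_iff.2 v.isPrime.ne_top
  have hq : 2 ≤ qv v := Finite.one_lt_card
  have hbdd : BddBelow (Set.range fun n : ℕ => (qv v : ℤ) ^ n - n * w) := by
    refine ⟨-(w * w : ℤ), ?_⟩
    rintro _ ⟨n, rfl⟩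
    have h1 : n * w ≤ qv v ^ n + w * w := by
      rcases le_total n w with h | h
      · exact (Nat.mul_le_mul_right w h).trans (Nat.le_add_left _ _)
      · obtain ⟨m, rfl⟩ := Nat.exists_eq_add_of_le h
        have hm : m ≤ qv v ^ m := (Nat.lt_pow_self (by omega)).le
        have hw : w ≤ qv v ^ w := (Nat.lt_pow_self (by omega)).le
        have := Nat.mul_le_mul hw hm
        rw [pow_add]
        nlinarith
    have h2 : (n * w : ℤ) ≤ (qv v : ℤ) ^ n + w * w := by exact_mod_cast h1
    change -(w * w : ℤ) ≤ (qv v : ℤ) ^ n - n * w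
    linarith
  exact ⟨Int.csInf_mem (Set.range_nonempty _) hbdd, fun _ h => csInf_le hbdd h⟩

open scoped Classical in
/-- The additive valuation `ord_v` on `k_v`, normalized by `ord_v(v) = 1`, with
`ord_v(0) = ∞`. -/
def ordv (x : v.adicCompletion (RatFunc F)) : WithTop ℚ :=
  if x = 0 then ⊤ else ((-(WithZero.log (Valued.v x)) : ℤ) : ℚ)

end MZV

end

end VadicMZV

/-!
Let `d` be the degree of `v`. Since `θ^{q^i} - θ` is divisible by `v` only if `d ∣ i`, and then
exactly once, the functional equation `log_G ∘ ρ_t = (θ + N) ∘ log_G` shows that the relevant row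
of the `i`-th coefficient of `log_G` has `v`-adic order at least `-wt(𝔰) ⌊i / d⌋`. At a point with
coordinates in `𝔪_v` the `i`-th term therefore has order at least
`q^i - wt(𝔰) ⌊i / d⌋ ≥ B_{wt(𝔰),v}`. Over the finite field `A / v`, some `ρ_a` with `a(θ)` prime to
`v` annihilates all points of `G`; hence dividing by `a(θ)` loses nothing and the bound persists
for `Li⋆`. Finally the order of `Γ_𝔰` is at most `(wt(𝔰) - dep(𝔰) - ht(𝔰)) / (q_v - 1)`, as in
Legendre's formula for factorials.
-/

namespace VadicMZV

open WithZero Filter Topology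

section Places

variable {F : Type*} [Field F]

/-- The order of vanishing `ord_v(f)` of `f ∈ A`, meaningful for `f ≠ 0` only
(`ordA v 0 = 0`, since `log 0 = 0`). -/
noncomputable def ordA (v : HeightOneSpectrum F[X]) (f : F[X]) : ℤ := -log (v.intValuation f)

/-- The degree of `v` over `𝔽_q`, so that `q_v = q ^ placeDegree v`. -/
noncomputable def placeDegree (v : HeightOneSpectrum F[X]) : ℕ :=
  Module.finrank F (F[X] ⧸ v.asIdeal)

variable (v : HeightOneSpectrum F[X])

lemma intValuation_eq_exp_neg_ordA {f : F[X]} (hf : f ≠ 0) :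
    v.intValuation f = exp (-ordA v f) := by
  rw [ordA, neg_neg, exp_log (v.intValuation_ne_zero f hf)]

lemma le_ordA_iff {f : F[X]} (hf : f ≠ 0) (n : ℕ) : n ≤ ordA v f ↔ f ∈ v.asIdeal ^ n := by
  rw [← v.intValuation_le_pow_iff_mem, intValuation_eq_exp_neg_ordA v hf, exp_le_exp,
    neg_le_neg_iff]

lemma ordA_nonneg {f : F[X]} (hf : f ≠ 0) : 0 ≤ ordA v f := by
  simpa using (le_ordA_iff v hf 0).2

lemma ordA_one : ordA v 1 = 0 := by simp [ordA]

lemma ordA_mul {f g : F[X]} (hf : f ≠ 0) (hg : g ≠ 0) :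
    ordA v (f * g) = ordA v f + ordA v g := by
  rw [ordA, map_mul, log_mul (v.intValuation_ne_zero f hf) (v.intValuation_ne_zero g hg), neg_add,
    ordA, ordA]

lemma ordA_pow (f : F[X]) (n : ℕ) : ordA v (f ^ n) = n * ordA v f := by
  rw [ordA, map_pow, log_pow, ordA, nsmul_eq_mul, mul_neg]

lemma ordA_prod {ι : Type*} (t : Finset ι) {f : ι → F[X]} (hf : ∀ i, f i ≠ 0) :
    ordA v (∏ i ∈ t, f i) = ∑ i ∈ t, ordA v (f i) := by
  classical
  induction t using Finset.induction_on with
  | empty => exact ordA_one v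
  | insert i t hi ih =>
    rw [Finset.prod_insert hi, Finset.sum_insert hi,
      ordA_mul v (hf i) (Finset.prod_ne_zero_iff.2 fun j _ => hf j), ih]

lemma derivative_mem_of_mem_sq {I : Ideal F[X]} {f : F[X]} (hf : f ∈ I ^ 2) :
    derivative f ∈ I := by
  rw [pow_two] at hf
  refine Submodule.mul_induction_on hf (fun a ha b hb => ?_) fun a b ha hb => ?_
  · rw [derivative_mul]
    exact add_mem (I.mul_mem_left _ hb) (I.mul_mem_right _ ha)
  · rw [derivative_add]
    exact add_mem ha hb

lemma placeDegree_pos [Finite F] : 0 < placeDegree v := by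
  have := Fintype.ofFinite F
  have := finite_residue v
  have : Nontrivial (F[X] ⧸ v.asIdeal) := Ideal.Quotient.nontrivial_iff.2 v.isPrime.ne_top
  exact Module.finrank_pos

section Fintype

variable [Fintype F]

lemma frobeniusAlgHom_pow_apply {R : Type*} [CommRing R] [Algebra F R] (i : ℕ) (x : R) :
    (FiniteField.frobeniusAlgHom F R ^ i) x = x ^ Fintype.card F ^ i := by
  rw [AlgHom.coe_pow, FiniteField.coe_frobeniusAlgHom, pow_iterate]

lemma qv_eq : qv v = Fintype.card F ^ placeDegree v := by
  have := finite_residue v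
  rw [qv, placeDegree, Module.natCard_eq_pow_finrank (K := F), Nat.card_eq_fintype_card]

lemma bracket_mem_iff (i : ℕ) : bracket F i ∈ v.asIdeal ↔ placeDegree v ∣ i := by
  have := finite_residue v
  have := v.isMaximal
  let _ := Ideal.Quotient.field v.asIdeal
  have hX : FiniteField.frobeniusAlgHom F (F[X] ⧸ v.asIdeal) ^ i = 1 ↔
      Ideal.Quotient.mk v.asIdeal X ^ Fintype.card F ^ i = Ideal.Quotient.mk v.asIdeal X := by
    rw [← frobeniusAlgHom_pow_apply]
    exact ⟨fun h => by rw [h, AlgHom.one_apply],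
      fun h => Ideal.Quotient.algHom_ext F (Polynomial.algHom_ext h)⟩
  rw [placeDegree, ← FiniteField.orderOf_frobeniusAlgHom F (F[X] ⧸ v.asIdeal),
    orderOf_dvd_iff_pow_eq_one, hX, ← Ideal.Quotient.eq_zero_iff_mem, bracket, map_sub, map_pow,
    sub_eq_zero]

lemma bracket_notMem_sq (i : ℕ) : bracket F (i + 1) ∉ v.asIdeal ^ 2 := by
  intro h
  have hder : derivative (bracket F (i + 1)) = -1 := by
    simp [bracket, derivative_X_pow]
  have hone := derivative_mem_of_mem_sq h
  rw [hder, neg_mem_iff] at hone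
  exact v.isPrime.ne_top ((Ideal.eq_top_iff_one _).2 hone)

lemma ordA_bracket (i : ℕ) :
    ordA v (bracket F (i + 1)) = if placeDegree v ∣ i + 1 then 1 else 0 := by
  have hone := le_ordA_iff v (bracket_ne_zero F i) 1
  have htwo := (le_ordA_iff v (bracket_ne_zero F i) 2).not.2 (bracket_notMem_sq v i)
  have hnonneg := ordA_nonneg v (bracket_ne_zero F i)
  rw [pow_one, bracket_mem_iff] at hone
  split_ifs with h <;> simp only [h, iff_true, iff_false] at hone <;> push_cast at hone htwo <;>
    omega

lemma ordA_carlitzD (j : ℕ) : ((qv v : ℤ) - 1) * ordA v (carlitzD F j) =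
    (Fintype.card F : ℤ) ^ j - (Fintype.card F : ℤ) ^ (j % placeDegree v) := by
  induction j with
  | zero => simp [carlitzD, ordA_one]
  | succ j ih =>
    set q := Fintype.card F
    set d := placeDegree v
    rw [carlitzD_succ, ordA_mul v (bracket_ne_zero F j) (pow_ne_zero _ (carlitzD_ne_zero F j)),
      ordA_pow, ordA_bracket, mul_add, mul_left_comm, ih, qv_eq]
    have hcarry : (j + 1) % d + d * (if d ∣ j + 1 then 1 else 0) = j % d + 1 := by
      have hdiv := congrArg (d * ·) (Nat.succ_div (a := j) (b := d))
      simp only [mul_add] at hdiv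
      linarith [Nat.div_add_mod j d, Nat.div_add_mod (j + 1) d]
    split_ifs at hcarry ⊢ with h
    · rw [Nat.mod_eq_zero_of_dvd h, zero_add, mul_one] at hcarry
      rw [Nat.mod_eq_zero_of_dvd h]
      calc _ = (q : ℤ) ^ d - 1 + (q ^ (j + 1) - q ^ (j % d + 1)) := by push_cast; ring
        _ = _ := by rw [← hcarry]; ring
    · rw [mul_zero, add_zero] at hcarry
      rw [hcarry]
      ring

lemma sum_digits_mul_pow (q n N : ℕ) :
    ∑ j ∈ Finset.range N, n / q ^ j % q * q ^ j = n % q ^ N := by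
  induction N with
  | zero => simp [Nat.mod_one]
  | succ N ih => rw [Finset.sum_range_succ, ih, Nat.mod_pow_succ, mul_comm]

lemma ordA_carlitzGammaSucc_le (n : ℕ) :
    ((qv v : ℤ) - 1) * ordA v (carlitzGammaSucc F n) ≤ n - if n = 0 then 0 else 1 := by
  set q := Fintype.card F
  set c : ℕ → ℕ := fun j => n / q ^ j % q
  have hdigits : ∑ j ∈ Finset.range (n + 1), c j * q ^ j = n := by
    rw [sum_digits_mul_pow, Nat.mod_eq_of_lt]
    exact (Nat.lt_succ_self n).trans (Nat.lt_pow_self (one_lt_q F))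
  have hsum : (if n = 0 then 0 else 1) ≤ ∑ j ∈ Finset.range (n + 1), c j := by
    split_ifs with hn
    · exact Nat.zero_le _
    · by_contra! hlt
      refine hn (hdigits.symm.trans (Finset.sum_eq_zero fun j hj => ?_))
      rw [Finset.sum_eq_zero_iff.1 (Nat.lt_one_iff.1 hlt) j hj, zero_mul]
  have hterm (j : ℕ) :
      ((qv v : ℤ) - 1) * (c j * ordA v (carlitzD F j)) ≤ c j * (q : ℤ) ^ j - c j := by
    have hpow : (1 : ℤ) ≤ (q : ℤ) ^ (j % placeDegree v) :=
      mod_cast Nat.one_le_pow _ _ Fintype.card_pos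
    rw [mul_left_comm, ordA_carlitzD, ← mul_sub_one]
    gcongr
  calc ((qv v : ℤ) - 1) * ordA v (carlitzGammaSucc F n)
      = ∑ j ∈ Finset.range (n + 1), ((qv v : ℤ) - 1) * (c j * ordA v (carlitzD F j)) := by
        rw [carlitzGammaSucc, ordA_prod v _ fun j => pow_ne_zero _ (carlitzD_ne_zero F j),
          Finset.mul_sum]
        simp only [ordA_pow, c, q]
    _ ≤ ∑ j ∈ Finset.range (n + 1), (c j * (q : ℤ) ^ j - c j) :=
        Finset.sum_le_sum fun j _ => hterm j
    _ = n - ∑ j ∈ Finset.range (n + 1), (c j : ℤ) := by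
        rw [Finset.sum_sub_distrib]
        congr 1
        exact_mod_cast hdigits
    _ ≤ n - if n = 0 then 0 else 1 := by
        gcongr
        exact_mod_cast hsum

lemma ordA_carlitzGammaIndex_le {r : ℕ} {s : Fin r → ℕ} (hs : ∀ i, 0 < s i) :
    ((qv v : ℤ) - 1) * ordA v (carlitzGammaIndex F s) ≤ weight s - r - height s := by
  have hsum : (weight s : ℤ) - r - height s =
      ∑ i, ((s i : ℤ) - 1 - if s i ≠ 1 then 1 else 0) := by
    simp [weight, height, Finset.sum_sub_distrib, Finset.card_filter]
  rw [carlitzGammaIndex, ordA_prod v _ fun i => carlitzGammaSucc_ne_zero F _, hsum, Finset.mul_sum]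
  refine Finset.sum_le_sum fun i _ => (ordA_carlitzGammaSucc_le v _).trans_eq ?_
  have := hs i
  rw [Nat.cast_sub this, Nat.cast_one]
  congr 1
  split_ifs <;> omega

end Fintype

lemma finite_setOf_qv_lt [Finite F] (w : ℕ) :
    {v : HeightOneSpectrum F[X] | qv v < w}.Finite := by
  have := Fintype.ofFinite F
  have hne : ∏ i ∈ Finset.range w, bracket F (i + 1) ≠ 0 :=
    Finset.prod_ne_zero_iff.2 fun i _ => bracket_ne_zero F i
  refine (Ideal.finite_factors (I := Ideal.span {∏ i ∈ Finset.range w, bracket F (i + 1)})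
    (by simpa [Ideal.zero_eq_bot] using hne)).subset fun v (hv : qv v < w) => ?_
  have hpos := placeDegree_pos v
  have hlt : placeDegree v < qv v := qv_eq v ▸ Nat.lt_pow_self (one_lt_q F)
  have hmem : bracket F (placeDegree v - 1 + 1) ∈ v.asIdeal := by
    rw [bracket_mem_iff, Nat.sub_add_cancel hpos]
  exact Ideal.dvd_span_singleton.2 (Ideal.mem_of_dvd _
    (Finset.dvd_prod_of_mem _ (Finset.mem_range.2 (by omega))) hmem)

lemma one_lt_qv [Finite F] : 1 < qv v := by
  have := Fintype.ofFinite F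
  rw [qv_eq]
  exact Nat.one_lt_pow (placeDegree_pos v).ne' (one_lt_q F)

lemma boundB_le [Finite F] (w n : ℕ) : boundB v w ≤ (qv v : ℤ) ^ n - n * w :=
  have := Fintype.ofFinite F
  (isLeast_boundB v w).2 ⟨n, rfl⟩

lemma boundB_le_card_pow_sub [Fintype F] (w i : ℕ) :
    boundB v w ≤ (Fintype.card F : ℤ) ^ i - (w * (i / placeDegree v) : ℕ) := by
  have hpow : qv v ^ (i / placeDegree v) ≤ Fintype.card F ^ i := by
    rw [qv_eq, ← pow_mul]
    exact Nat.pow_le_pow_right Fintype.card_pos (Nat.mul_div_le i _)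
  refine (boundB_le v w (i / placeDegree v)).trans ?_
  rw [Nat.cast_mul, mul_comm]
  gcongr
  exact_mod_cast hpow

lemma boundB_nonneg [Finite F] {w : ℕ} (hw : w ≤ qv v) : 0 ≤ boundB v w := by
  refine le_ciInf fun n => sub_nonneg.2 ?_
  have hpow : n * w ≤ qv v ^ n := by
    calc n * w ≤ qv v * n := by rw [mul_comm]; gcongr
      _ ≤ qv v ^ n := Nat.mul_le_pow (one_lt_qv v).ne' n
  exact_mod_cast hpow

end Places

section Matrices

variable {R : Type*} [CommRing R] {r : ℕ} {s : Fin r → ℕ}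

lemma coord_ext_iff {p p' : Coord s} : p = p' ↔ p.1 = p'.1 ∧ (p.2 : ℕ) = p'.2 := by
  refine ⟨by rintro rfl; exact ⟨rfl, rfl⟩, fun ⟨hl, hk⟩ => ?_⟩
  obtain ⟨l, k⟩ := p
  obtain ⟨l', k'⟩ := p'
  obtain rfl : l = l' := hl
  exact congrArg _ (Fin.ext hk)

lemma matN_row_last {p : Coord s} (hp : (p.2 : ℕ) + 1 = blockDim s p.1) : matN R s p = 0 := by
  funext p'
  refine if_neg fun ⟨hl, hk⟩ => ?_
  have hlt : (p'.2 : ℕ) < blockDim s p.1 :=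
    p'.2.2.trans_eq (congrArg (blockDim s) hl.symm)
  exact hlt.ne' (hp.symm.trans hk)

lemma matN_row_of_lt {l : Fin r} {k : ℕ} (hk : k + 1 < blockDim s l) :
    matN R s ⟨l, k, by omega⟩ = Pi.single ⟨l, k + 1, hk⟩ 1 := by
  funext p'
  rw [Pi.single_apply]
  exact if_congr
    ((and_congr eq_comm eq_comm).trans (coord_ext_iff (p' := ⟨l, k + 1, hk⟩)).symm) rfl rfl

lemma matN_col_zero {l : Fin r} (hl : 0 < blockDim s l) : (matN R s).col ⟨l, 0, hl⟩ = 0 := by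
  funext p
  exact if_neg fun h => (Nat.succ_ne_zero _) h.2

lemma matN_col_succ {l : Fin r} {k : ℕ} (hk : k + 1 < blockDim s l) :
    (matN R s).col ⟨l, k + 1, hk⟩ = Pi.single ⟨l, k, by omega⟩ 1 := by
  funext p
  rw [Pi.single_apply]
  exact if_congr ((and_congr Iff.rfl Nat.succ_inj).trans
    (coord_ext_iff (p' := ⟨l, k, by omega⟩)).symm) rfl rfl

lemma matE_row_of_ne (u : Fin r → R) {p : Coord s} (hp : (p.2 : ℕ) + 1 ≠ blockDim s p.1) :
    matE s u p = 0 :=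
  funext fun _ => if_neg fun h => hp h.2.1

lemma matE_col_of_ne (u : Fin r → R) {p : Coord s} (hp : (p.2 : ℕ) ≠ 0) :
    (matE s u).col p = 0 :=
  funext fun _ => if_neg fun h => hp h.2.2

lemma matE_apply_of_lt (u : Fin r → R) {p p' : Coord s} (h : p'.1 < p.1) : matE s u p p' = 0 :=
  if_neg fun h' => h'.1.not_gt h

lemma matN_apply_of_ne {p p' : Coord s} (h : p'.1 ≠ p.1) : matN R s p p' = 0 :=
  if_neg fun h' => h h'.1.symm

lemma map_matN {S : Type*} [CommRing S] (f : R →+* S) : (matN R s).map f = matN S s := by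
  ext p p'
  simp [matN, apply_ite f]

lemma map_matE {S : Type*} [CommRing S] (f : R →+* S) (u : Fin r → R) :
    (matE s u).map f = matE s (f ∘ u) := by
  ext p p'
  simp [matE, apply_ite f]

end Matrices

section Points

variable {F R : Type*} [Field F] [Fintype F] [CommRing R] [Algebra F R] {r : ℕ}

variable (F) in
/-- `ρ_t = θ + N + E τ` acting on the points of `G_{𝔰,𝐮}` over an arbitrary `𝔽_q`-algebra `R`
with a distinguished element `θ`; `rhoT` is the case `R = A`. -/
def pointsRhoT (θ : R) (s : Fin r → ℕ) (u : Fin r → R) : Module.End F (Coord s → R) :=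
  θ • LinearMap.id + (matN R s).mulVecLin.restrictScalars F +
    (matE s u).mulVecLin.restrictScalars F ∘ₗ
      (FiniteField.frobeniusAlgHom F R).toLinearMap.compLeft (Coord s)

lemma pointsRhoT_apply (θ : R) (s : Fin r → ℕ) (u : Fin r → R) (x : Coord s → R) :
    pointsRhoT F θ s u x =
      θ • x + (matN R s).mulVec x + (matE s u).mulVec fun p => x p ^ Fintype.card F := rfl

lemma map_pointsRhoT {S : Type*} [CommRing S] [Algebra F S] (f : R →ₐ[F] S) (θ : R)
    (s : Fin r → ℕ) (u : Fin r → R) (x : Coord s → R) :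
    f ∘ pointsRhoT F θ s u x = pointsRhoT F (f θ) s (f ∘ u) (f ∘ x) := by
  funext p
  have hN := RingHom.map_mulVec (f : R →+* S) (matN R s) x p
  have hE := RingHom.map_mulVec (f : R →+* S) (matE s u) (fun p => x p ^ Fintype.card F) p
  rw [map_matN] at hN
  rw [map_matE] at hE
  simp only [RingHom.coe_coe] at hN hE
  simp [pointsRhoT_apply, hN, hE, Function.comp_def]

lemma map_pow_card_pow_matE (s : Fin r → ℕ) (u : Fin r → R) (i : ℕ) :
    (matE s u).map (· ^ Fintype.card F ^ i) = matE s fun e => u e ^ Fintype.card F ^ i := by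
  simp only [← frobeniusAlgHom_pow_apply]
  exact map_matE (FiniteField.frobeniusAlgHom F R ^ i).toRingHom u

lemma map_pow_card_pow_smul_one_add_matN (s : Fin r → ℕ) (θ : R) (i : ℕ) :
    (θ • 1 + matN R s).map (· ^ Fintype.card F ^ i) =
      θ ^ Fintype.card F ^ i • 1 + matN R s := by
  simp only [← frobeniusAlgHom_pow_apply]
  refine (map_add (FiniteField.frobeniusAlgHom F R ^ i).toRingHom.mapMatrix _ _).trans ?_
  rw [RingHom.mapMatrix_apply, RingHom.mapMatrix_apply, map_matN, Matrix.smul_one_eq_diagonal,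
    Matrix.diagonal_map (map_zero _), Matrix.smul_one_eq_diagonal]
  rfl

end Points

section Semiconj

variable {F κ M N : Type*} [Field F] [Field κ] [Algebra F κ] [AddCommGroup M] [Module F M]
  [AddCommGroup N] [Module F N] [Module κ N] [IsScalarTower F κ N]

lemma map_aeval_apply_of_semiconj (f : M →ₗ[F] N) {T : Module.End F M} {S : Module.End κ N}
    (h : ∀ x, f (T x) = S (f x)) (a : F[X]) (x : M) :
    f (aeval T a x) = aeval S a (f x) := by
  have hpow (n : ℕ) : ∀ x, f ((T ^ n) x) = (S ^ n) (f x) := fun x => by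
    rw [Module.End.pow_apply, Module.End.pow_apply]
    exact Function.Semiconj.iterate_right h n x
  induction a using Polynomial.induction_on' generalizing x with
  | add a b ha hb => simp only [map_add, LinearMap.add_apply, ha, hb]
  | monomial n c =>
    rw [aeval_monomial, aeval_monomial, Module.End.mul_apply, Module.algebraMap_end_apply, map_smul,
      hpow, ← Algebra.smul_def, LinearMap.smul_apply]

end Semiconj

section Residue

variable {F κ : Type*} [Field F] [Fintype F] [Field κ] [Algebra F κ]

lemma exists_map_eq_prod_conjugates [Finite κ] (θ : κ) : ∃ g : F[X], g.map (algebraMap F κ) =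
    ∏ j ∈ Finset.range (Module.finrank F κ), (X - C (θ ^ Fintype.card F ^ j)) := by
  have := Fintype.ofFinite Gal(κ/F)
  obtain ⟨g, hg⟩ := (mem_lifts _).1 (Algebra.IsInvariant.charpoly_mem_lifts F κ Gal(κ/F) θ)
  refine ⟨g, hg.trans ?_⟩
  rw [MulSemiringAction.charpoly_eq, Finset.prod_range]
  refine (Fintype.prod_bijective _ (FiniteField.bijective_frobeniusAlgEquivOfAlgebraic_pow F κ) _ _
    fun j => ?_).symm
  rw [AlgEquiv.smul_def, AlgEquiv.coe_pow, FiniteField.coe_frobeniusAlgEquivOfAlgebraic_iterate]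

variable (κ) in
/-- The left shift of sequences, through which `𝔽_q[t]` acts on the orbits of `ρ_t`. -/
def seqShift : Module.End κ (ℕ → κ) := LinearMap.funLeft κ κ Nat.succ

lemma comp_aeval_seqShift (φ : κ →+* κ) (p : κ[X]) (y : ℕ → κ) :
    φ ∘ aeval (seqShift κ) p y = aeval (seqShift κ) (p.map φ) (φ ∘ y) := by
  have hpow (n : ℕ) : ∀ y : ℕ → κ, φ ∘ (seqShift κ ^ n) y = (seqShift κ ^ n) (φ ∘ y) := fun y => by
    rw [Module.End.pow_apply, Module.End.pow_apply]
    exact Function.Semiconj.iterate_right (f := (φ ∘ ·)) (ga := seqShift κ) (fun _ => rfl) n y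
  induction p using Polynomial.induction_on' with
  | add p p' hp hp' =>
    rw [Polynomial.map_add, map_add, map_add, LinearMap.add_apply, LinearMap.add_apply, ← hp, ← hp']
    exact funext fun _ => map_add φ _ _
  | monomial n c =>
    rw [map_monomial, aeval_monomial, aeval_monomial, Module.End.mul_apply, Module.End.mul_apply,
      Module.algebraMap_end_apply, Module.algebraMap_end_apply, ← hpow]
    exact funext fun _ => map_mul φ _ _

lemma pow_card_pow_finrank [Finite κ] (x : κ) :
    x ^ Fintype.card F ^ Module.finrank F κ = x := by
  have := Fintype.ofFinite κ
  rw [← Module.card_eq_pow_finrank, FiniteField.pow_card]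

/-- The relation says `y^{(1)} = (L - θ)^n y` for the shift `L`. Iterating it,
`y^{(j)} = ∏_{i < j} (L - θ^{q^i})^n y`, and `y^{(j)} = y` when `q^j = #κ`. -/
lemma aeval_seqShift_eq_self [Finite κ] {θ : κ} {n : ℕ} {y : ℕ → κ}
    (hy : FiniteField.frobeniusAlgHom F κ ∘ y = aeval (seqShift κ) ((X - C θ) ^ n) y) :
    aeval (seqShift κ) ((∏ j ∈ Finset.range (Module.finrank F κ),
      (X - C (θ ^ Fintype.card F ^ j))) ^ n) y = y := by
  have htwist (j : ℕ) : (FiniteField.frobeniusAlgHom F κ ^ j) ∘ y = aeval (seqShift κ)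
      ((∏ i ∈ Finset.range j, (X - C (θ ^ Fintype.card F ^ i))) ^ n) y := by
    induction j with
    | zero => simp; rfl
    | succ j ih =>
      have hcomp := comp_aeval_seqShift (FiniteField.frobeniusAlgHom F κ ^ j : κ →ₐ[F] κ).toRingHom
        ((X - C θ) ^ n) y
      simp only [AlgHom.toRingHom_eq_coe, RingHom.coe_coe, ← hy, ih, Polynomial.map_pow,
        Polynomial.map_sub, map_X, map_C, frobeniusAlgHom_pow_apply] at hcomp
      rw [pow_succ, Finset.prod_range_succ, mul_comm, mul_pow, map_mul, Module.End.mul_apply,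
        ← hcomp]
      rfl
  rw [← htwist]
  funext i
  rw [Function.comp_apply, frobeniusAlgHom_pow_apply, pow_card_pow_finrank]

end Residue

section Filtration

variable {F κ : Type*} [Field F] [Field κ] [Algebra F κ] {r : ℕ} {s : Fin r → ℕ}

variable (F κ s) in
/-- The points of `G_{𝔰,𝐮}` supported in the first `l` blocks. They form a `t`-submodule with
successive quotients isomorphic to the tensor powers of the Carlitz module. -/
def firstBlocks (l : ℕ) : Submodule F (Coord s → κ) where
  carrier := {x | ∀ p, l ≤ (p.1 : ℕ) → x p = 0}
  add_mem' hx hy p hp := by rw [Pi.add_apply, hx p hp, hy p hp, add_zero]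
  zero_mem' _ _ := rfl
  smul_mem' c x hx p hp := by rw [Pi.smul_apply, hx p hp, smul_zero]

lemma mem_firstBlocks_succ {l : Fin r} {x : Coord s → κ} (hx : x ∈ firstBlocks F κ s (l + 1)) :
    x ∈ firstBlocks F κ s l ↔ ∀ k, x ⟨l, k⟩ = 0 := by
  refine ⟨fun h k => h ⟨l, k⟩ le_rfl, fun h ⟨m, k⟩ hm => ?_⟩
  obtain hlt | heq := hm.lt_or_eq
  · exact hx ⟨m, k⟩ hlt
  · obtain rfl : l = m := Fin.ext heq
    exact h k

variable [Fintype F] {θ : κ} {u : Fin r → κ}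

lemma pointsRhoT_mem_firstBlocks {l : ℕ} {x : Coord s → κ} (hx : x ∈ firstBlocks F κ s l) :
    pointsRhoT F θ s u x ∈ firstBlocks F κ s l := by
  intro p hp
  have hN : (matN κ s).mulVec x p = 0 := Finset.sum_eq_zero fun p' _ => by
    by_cases h : p'.1 = p.1
    · exact mul_eq_zero_of_right _ (hx p' (h ▸ hp))
    · exact mul_eq_zero_of_left (matN_apply_of_ne h) _
  have hE : (matE s u).mulVec (fun p => x p ^ Fintype.card F) p = 0 :=
    Finset.sum_eq_zero fun p' _ => by
      obtain h | h := lt_or_ge p'.1 p.1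
      · exact mul_eq_zero_of_left (matE_apply_of_lt u h) _
      · exact mul_eq_zero_of_right _ (by simp [hx p' (hp.trans h)])
  simp [pointsRhoT_apply, hx p hp, hN, hE]

lemma aeval_pointsRhoT_mem_firstBlocks (a : F[X]) {l : ℕ} {x : Coord s → κ}
    (hx : x ∈ firstBlocks F κ s l) : aeval (pointsRhoT F θ s u) a x ∈ firstBlocks F κ s l :=
  aeval_apply_smul_mem_of_le_comap hx a _ fun _ => pointsRhoT_mem_firstBlocks

lemma pointsRhoT_apply_of_lt (x : Coord s → κ) {l : Fin r} {k : ℕ} (hk : k + 1 < blockDim s l) :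
    pointsRhoT F θ s u x ⟨l, k, by omega⟩ = θ * x ⟨l, k, by omega⟩ + x ⟨l, k + 1, hk⟩ := by
  rw [pointsRhoT_apply, Pi.add_apply, Pi.add_apply, Matrix.mulVec, Matrix.mulVec,
    matN_row_of_lt hk, matE_row_of_ne u (p := ⟨l, k, _⟩) hk.ne, single_one_dotProduct,
    zero_dotProduct, add_zero, Pi.smul_apply, smul_eq_mul]

lemma pointsRhoT_apply_last {l : Fin r} {k : ℕ} (hk : k + 1 = blockDim s l) {x : Coord s → κ}
    (hx : x ∈ firstBlocks F κ s (l + 1)) :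
    pointsRhoT F θ s u x ⟨l, k, by omega⟩ =
      θ * x ⟨l, k, by omega⟩ + x ⟨l, 0, by omega⟩ ^ Fintype.card F := by
  have hE : (matE s u).mulVec (fun p => x p ^ Fintype.card F) ⟨l, k, by omega⟩ =
      x ⟨l, 0, by omega⟩ ^ Fintype.card F := by
    refine (Finset.sum_eq_single ⟨l, 0, by omega⟩ (fun p _ hp => ?_) (by simp)).trans ?_
    · obtain h | h | h := lt_trichotomy p.1 l
      · exact mul_eq_zero_of_left (matE_apply_of_lt u h) _
      · exact mul_eq_zero_of_left (if_neg fun h' => hp (coord_ext_iff.2 ⟨h, h'.2.2⟩)) _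
      · exact mul_eq_zero_of_right _ (by simp [hx p h])
    · simp [matE, hk]
  rw [pointsRhoT_apply, Pi.add_apply, Pi.add_apply, hE, Matrix.mulVec,
    matN_row_last (p := ⟨l, k, _⟩) hk, zero_dotProduct, add_zero, Pi.smul_apply, smul_eq_mul]

variable (F θ s u) in
/-- The sequence `i ↦ (ρ_t^i x)_p`. -/
def coordOrbit (p : Coord s) : (Coord s → κ) →ₗ[F] (ℕ → κ) where
  toFun x i := (pointsRhoT F θ s u ^ i) x p
  map_add' x y := by simp only [map_add]; rfl
  map_smul' c x := by simp only [map_smul]; rfl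

lemma coordOrbit_aeval (p : Coord s) (a : F[X]) (x : Coord s → κ) :
    coordOrbit F s θ u p (aeval (pointsRhoT F θ s u) a x) =
      aeval (seqShift κ) a (coordOrbit F s θ u p x) := by
  refine map_aeval_apply_of_semiconj _ (fun x => _root_.funext fun i => ?_) a x
  change (pointsRhoT F θ s u ^ i) _ p = (pointsRhoT F θ s u ^ (i + 1)) x p
  rw [pow_succ, Module.End.mul_apply]

lemma pointsRhoT_pow_mem_firstBlocks (i : ℕ) {l : ℕ} {x : Coord s → κ}
    (hx : x ∈ firstBlocks F κ s l) : (pointsRhoT F θ s u ^ i) x ∈ firstBlocks F κ s l := by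
  simpa using aeval_pointsRhoT_mem_firstBlocks (X ^ i) hx

lemma coordOrbit_eq_aeval_first (x : Coord s → κ) {l : Fin r} {k : ℕ} (hk : k < blockDim s l) :
    coordOrbit F s θ u ⟨l, k, hk⟩ x =
      aeval (seqShift κ) ((X - C θ) ^ k) (coordOrbit F s θ u ⟨l, 0, by omega⟩ x) := by
  induction k with
  | zero => simp
  | succ k ih =>
    rw [pow_succ', map_mul, Module.End.mul_apply, ← ih (by omega), map_sub, aeval_X, aeval_C,
      LinearMap.sub_apply, Module.algebraMap_end_apply, eq_sub_iff_add_eq']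
    funext i
    have h := pointsRhoT_apply_of_lt (F := F) (θ := θ) (u := u) ((pointsRhoT F θ s u ^ i) x) hk
    rw [← Module.End.mul_apply, ← pow_succ'] at h
    exact h.symm

lemma frobenius_comp_coordOrbit_first {l : Fin r} (hl : 0 < blockDim s l) {x : Coord s → κ}
    (hx : x ∈ firstBlocks F κ s (l + 1)) :
    FiniteField.frobeniusAlgHom F κ ∘ coordOrbit F s θ u ⟨l, 0, hl⟩ x =
      aeval (seqShift κ) ((X - C θ) ^ blockDim s l) (coordOrbit F s θ u ⟨l, 0, hl⟩ x) := by
  obtain ⟨k, hk⟩ := Nat.exists_eq_succ_of_ne_zero hl.ne'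
  have hpow : (X - C θ) ^ blockDim s l = (X - C θ) * (X - C θ) ^ k := by rw [hk, pow_succ']
  rw [hpow, map_mul, Module.End.mul_apply,
    ← coordOrbit_eq_aeval_first x (k := k) (by omega), map_sub, aeval_X, aeval_C,
    LinearMap.sub_apply, Module.algebraMap_end_apply, eq_sub_iff_add_eq']
  funext i
  have h := pointsRhoT_apply_last (θ := θ) (u := u) hk.symm
    (pointsRhoT_pow_mem_firstBlocks (θ := θ) (u := u) i hx)
  rw [← Module.End.mul_apply, ← pow_succ'] at h
  exact h.symm

/-- On the quotient by the first `l` blocks, `g ^ d_l` acts as the identity. -/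
lemma aeval_pow_sub_one_mem_firstBlocks [Finite κ] {g : F[X]}
    (hg : g.map (algebraMap F κ) =
      ∏ j ∈ Finset.range (Module.finrank F κ), (X - C (θ ^ Fintype.card F ^ j)))
    {l : Fin r} {x : Coord s → κ} (hx : x ∈ firstBlocks F κ s (l + 1)) :
    aeval (pointsRhoT F θ s u) (g ^ blockDim s l - 1) x ∈ firstBlocks F κ s l := by
  refine (mem_firstBlocks_succ (aeval_pointsRhoT_mem_firstBlocks _ hx)).2 fun ⟨k, hk⟩ => ?_
  set y := aeval (pointsRhoT F θ s u) (g ^ blockDim s l - 1) x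
  have hfirst : coordOrbit F s θ u ⟨l, 0, by omega⟩ y = 0 := by
    have h := aeval_seqShift_eq_self
      (frobenius_comp_coordOrbit_first (θ := θ) (u := u) (by omega) hx)
    rw [← hg, ← Polynomial.map_pow, aeval_map_algebraMap] at h
    rw [coordOrbit_aeval, map_sub, map_one, LinearMap.sub_apply, h, Module.End.one_apply, sub_self]
  have hrow := coordOrbit_eq_aeval_first (F := F) (θ := θ) (u := u) y hk
  rw [hfirst, map_zero] at hrow
  exact congrFun hrow 0

lemma exists_aeval_pointsRhoT_eq_zero [Finite κ] (θ : κ) (s : Fin r → ℕ) (u : Fin r → κ) :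
    ∃ a : F[X], aeval θ a ≠ 0 ∧ aeval (pointsRhoT F θ s u) a = 0 := by
  obtain ⟨g, hg⟩ := exists_map_eq_prod_conjugates (F := F) θ
  have hgθ : aeval θ g = 0 := by
    rw [← eval_map_algebraMap, hg, eval_prod]
    exact Finset.prod_eq_zero (Finset.mem_range.2 Module.finrank_pos) (by simp)
  have hblocks (m : ℕ) (hm : m ≤ r) : ∃ a : F[X], aeval θ a ≠ 0 ∧
      ∀ x ∈ firstBlocks F κ s m, aeval (pointsRhoT F θ s u) a x = 0 := by
    induction m with
    | zero =>
      exact ⟨1, by simp, fun x hx => funext fun p => by simpa using hx p (Nat.zero_le _)⟩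
    | succ m ih =>
      obtain ⟨a, haθ, ha⟩ := ih (by omega)
      let l : Fin r := ⟨m, hm⟩
      obtain hl | hl := Nat.eq_zero_or_pos (blockDim s l)
      · exact ⟨a, haθ, fun x hx => ha x ((mem_firstBlocks_succ (l := l) hx).2 fun k =>
          absurd k.2 (by omega))⟩
      · refine ⟨a * (g ^ blockDim s l - 1), ?_, fun x hx => ?_⟩
        · rw [map_mul, map_sub, map_pow, hgθ, zero_pow hl.ne', map_one, zero_sub, mul_neg_one]
          exact neg_ne_zero.2 haθ
        · rw [map_mul, Module.End.mul_apply]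
          exact ha _ (aeval_pow_sub_one_mem_firstBlocks hg (l := l) hx)
  obtain ⟨a, haθ, ha⟩ := hblocks r le_rfl
  exact ⟨a, haθ, LinearMap.ext fun x => ha x fun p hp => absurd p.1.2 (by omega)⟩

end Filtration

section Admissible

variable {F : Type*} [Field F] [Fintype F] {r : ℕ}

lemma map_rho_apply {R : Type*} [CommRing R] [Algebra F R] (f : F[X] →ₐ[F] R) (s : Fin r → ℕ)
    (u : Fin r → F[X]) (a : F[X]) (x : Coord s → F[X]) :
    f ∘ rho s u a x = aeval (pointsRhoT F (f X) s (f ∘ u)) a (f ∘ x) :=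
  map_aeval_apply_of_semiconj (κ := F) (f.toLinearMap.compLeft (Coord s))
    (map_pointsRhoT f X s u) a x

lemma exists_isAdmissible_notMem (v : HeightOneSpectrum F[X]) (s : Fin r → ℕ)
    (u : Fin r → F[X]) : ∃ a, IsAdmissible v s u a ∧ a ∉ v.asIdeal := by
  have := finite_residue v
  have := v.isMaximal
  let _ := Ideal.Quotient.field v.asIdeal
  let π := Ideal.Quotient.mkₐ F v.asIdeal
  obtain ⟨a, haθ, ha⟩ := exists_aeval_pointsRhoT_eq_zero (F := F) (π X) s (π ∘ u)
  have hmem : a ∉ v.asIdeal := by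
    rwa [aeval_algHom_apply, aeval_X_left_apply, Ne, Ideal.Quotient.mkₐ_eq_mk,
      Ideal.Quotient.eq_zero_iff_mem] at haθ
  refine ⟨a, ⟨fun h => hmem (h ▸ zero_mem _), fun p => ?_⟩, hmem⟩
  have hρ : π (rho s u a (specialPoint s u) p) = 0 := by
    have h := map_rho_apply π s u a (specialPoint s u)
    rw [ha] at h
    exact congrFun h p
  exact (HeightOneSpectrum.valuedAdicCompletion_eq_valuation v _).trans_lt
    ((HeightOneSpectrum.valuation_lt_one_iff_mem v _).2 (Ideal.Quotient.eq_zero_iff_mem.1 hρ))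

end Admissible

section TwistedSeries

variable {K ι : Type*} [Field K] [Fintype ι] {q : ℕ}

lemma ne_zero_of_forall_eq_pow {φ : K →+* K} (hφ : ∀ x, φ x = x ^ q) : q ≠ 0 := by
  rintro rfl
  simpa using hφ 0

lemma twConst_twMul (M : Matrix ι ι K) (P : ℕ → Matrix ι ι K) (n : ℕ) :
    twMul q (twConst M) P n = M * P n := by
  rw [twMul, Finset.sum_eq_single 0 (fun i _ hi => by rw [twConst, if_neg hi, zero_mul]) (by simp)]
  simp [twConst]

lemma one_twMul [DecidableEq ι] (P : ℕ → Matrix ι ι K) : twMul q (twConst 1) P = P :=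
  funext fun n => by rw [twConst_twMul, one_mul]

variable {φ : K →+* K} (hφ : ∀ x, φ x = x ^ q)
include hφ

lemma map_pow_eq_mapMatrix [DecidableEq ι] (i : ℕ) (M : Matrix ι ι K) :
    M.map (· ^ q ^ i) = (φ ^ i).mapMatrix M := by
  ext a b
  rw [Matrix.map_apply, RingHom.mapMatrix_apply, Matrix.map_apply, RingHom.coe_pow,
    show (φ : K → K) = (· ^ q) from _root_.funext hφ, pow_iterate]

lemma twMul_eq_sum_antidiagonal [DecidableEq ι] (P Q : ℕ → Matrix ι ι K) (n : ℕ) :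
    twMul q P Q n = ∑ x ∈ Finset.HasAntidiagonal.antidiagonal n,
      P x.1 * (φ ^ x.1).mapMatrix (Q x.2) := by
  simp only [Finset.Nat.sum_antidiagonal_eq_sum_range_succ_mk, twMul, map_pow_eq_mapMatrix hφ]

lemma twMul_assoc (P Q R : ℕ → Matrix ι ι K) :
    twMul q (twMul q P Q) R = twMul q P (twMul q Q R) := by
  classical
  funext n
  have hcomp (i j : ℕ) (M : Matrix ι ι K) :
      (φ ^ i).mapMatrix ((φ ^ j).mapMatrix M) = (φ ^ (i + j)).mapMatrix M :=
    Matrix.ext fun _ _ => by simp [pow_add, RingHom.mul_def]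
  simp only [twMul_eq_sum_antidiagonal hφ, map_sum, map_mul, Finset.sum_mul, Finset.mul_sum,
    Finset.sum_sigma', hcomp]
  refine Finset.sum_nbij' (fun x => ⟨(x.2.1, x.2.2 + x.1.2), (x.2.2, x.1.2)⟩)
    (fun x => ⟨(x.1.1 + x.2.1, x.2.2), (x.1.1, x.2.1)⟩) ?_ ?_ ?_ ?_ ?_ <;>
    rintro ⟨⟨i, j⟩, k, l⟩ h <;>
    simp only [Finset.mem_sigma, Finset.HasAntidiagonal.mem_antidiagonal] at h ⊢ <;>
    obtain ⟨rfl, rfl⟩ := h <;> simp [mul_assoc, add_assoc]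

variable [DecidableEq ι]

lemma twMul_one (P : ℕ → Matrix ι ι K) : twMul q P (twConst 1) = P := by
  funext n
  simp only [twMul, map_pow_eq_mapMatrix hφ]
  rw [Finset.sum_eq_single n]
  · simp only [Nat.sub_self, twConst, if_true, map_one, mul_one]
  · intro i hi hne
    have := Finset.mem_range.1 hi
    rw [twConst, if_neg (by omega), map_zero, mul_zero]
  · simp

lemma twMul_twLinear_succ (P : ℕ → Matrix ι ι K) (M E : Matrix ι ι K) (n : ℕ) :
    twMul q P (twLinear M E) (n + 1) =
      P (n + 1) * (φ ^ (n + 1)).mapMatrix M + P n * (φ ^ n).mapMatrix E := by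
  simp only [twMul, map_pow_eq_mapMatrix hφ]
  rw [Finset.sum_range_succ, Finset.sum_range_succ, Finset.sum_eq_zero, zero_add, add_comm]
  · simp [twLinear]
  · intro i hi
    have := Finset.mem_range.1 hi
    rw [twLinear, if_neg (by omega), if_neg (by omega), map_zero, mul_zero]

lemma twMul_twInv_right (Q : ℕ → Matrix ι ι K) (hQ : Q 0 = 1) :
    twMul q Q (twInv q Q) = twConst 1 := by
  have hq := ne_zero_of_forall_eq_pow hφ
  have hinv : twInv q (twInv q Q) = Q := by
    have hassoc := twMul_assoc hφ (twInv q (twInv q Q)) (twInv q Q) Q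
    rw [twMul_twInv q Q hQ hq, twMul_twInv q _ (by rw [twInv]) hq, twMul_one hφ,
      one_twMul] at hassoc
    exact hassoc.symm
  have h := twMul_twInv q (twInv q Q) (by rw [twInv]) hq
  rwa [hinv] at h

lemma IsExp.twInv_twMul_twLinear {M E : Matrix ι ι K} {Q : ℕ → Matrix ι ι K}
    (hQ : IsExp q M E Q) :
    twMul q (twInv q Q) (twLinear M E) = twMul q (twConst M) (twInv q Q) := by
  calc twMul q (twInv q Q) (twLinear M E)
      = twMul q (twInv q Q) (twMul q (twMul q (twLinear M E) Q) (twInv q Q)) := by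
        rw [twMul_assoc hφ (twLinear M E), twMul_twInv_right hφ Q hQ.1, twMul_one hφ]
    _ = twMul q (twMul q (twInv q Q) Q) (twMul q (twConst M) (twInv q Q)) := by
        rw [← hQ.2, twMul_assoc hφ, twMul_assoc hφ]
    _ = twMul q (twConst M) (twInv q Q) := by
        rw [twMul_twInv q Q hQ.1 (ne_zero_of_forall_eq_pow hφ), one_twMul]

end TwistedSeries

lemma valuation_dotProduct_le {R Γ ι : Type*} [CommRing R] [LinearOrderedCommMonoidWithZero Γ]
    [Fintype ι] (w : Valuation R Γ) {x y : ι → R} {a b : Γ} (hx : ∀ i, w (x i) ≤ a)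
    (hy : ∀ i, w (y i) ≤ b) : w (x ⬝ᵥ y) ≤ a * b :=
  w.map_sum_le fun i _ => (w.map_mul _ _).trans_le (mul_le_mul' (hx i) (hy i))

lemma valuation_matE_le_one {F : Type*} [Field F] (v : HeightOneSpectrum F[X]) {r : ℕ}
    {s : Fin r → ℕ} (u : Fin r → F[X]) (n : ℕ) (p p' : Coord s) :
    v.valuation (RatFunc F)
      (matE s (fun e => algebraMap F[X] (RatFunc F) (u e) ^ n) p p') ≤ 1 := by
  have hE : (matE s fun e => algebraMap F[X] (RatFunc F) (u e) ^ n) =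
      (matE s fun e => u e ^ n).map (algebraMap F[X] (RatFunc F)) := by
    rw [map_matE]
    simp only [Function.comp_def, map_pow]
  rw [hE]
  exact v.valuation_le_one _

section LogRow

variable {F : Type*} [Field F] [Fintype F] {r : ℕ} {s : Fin r → ℕ} {p₀ : Coord s}

lemma logCoeff_zero (u : Fin r → F[X]) : logCoeff F s u 0 = 1 := by rw [logCoeff, twInv]

/-- The row `p₀` of the identity `log ∘ ρ_t = ∂ρ_t ∘ log`; the row `p₀` of `N` vanishes. -/
lemma logCoeff_succ_row (hp₀ : (p₀.2 : ℕ) + 1 = blockDim s p₀.1) (u : Fin r → F[X]) (n : ℕ) :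
    (RatFunc.X : RatFunc F) ^ Fintype.card F ^ (n + 1) • logCoeff F s u (n + 1) p₀ +
      Matrix.vecMul (logCoeff F s u (n + 1) p₀) (matN (RatFunc F) s) +
      Matrix.vecMul (logCoeff F s u n p₀)
        (matE s fun e => algebraMap F[X] (RatFunc F) (u e) ^ Fintype.card F ^ n) =
    (RatFunc.X : RatFunc F) • logCoeff F s u (n + 1) p₀ := by
  let φ : RatFunc F →+* RatFunc F := (FiniteField.frobeniusAlgHom F (RatFunc F)).toRingHom
  have hexp : IsExp _ _ _ (expCoeff F s u) := (existsUnique_expCoeff F s u).choose_spec.1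
  have hlog := congrArg (Matrix.vecMul (Pi.single p₀ 1))
    (congrFun (hexp.twInv_twMul_twLinear (φ := φ) fun _ => rfl) (n + 1))
  rw [twMul_twLinear_succ (φ := φ) fun _ => rfl, twConst_twMul, ← map_pow_eq_mapMatrix fun _ => rfl,
    ← map_pow_eq_mapMatrix fun _ => rfl, map_pow_card_pow_smul_one_add_matN,
    map_pow_card_pow_matE] at hlog
  simp only [Matrix.vecMul_add, ← Matrix.vecMul_vecMul, Matrix.vecMul_smul,
    Matrix.smul_vecMul, Matrix.vecMul_one, Matrix.single_one_vecMul, Matrix.row,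
    matN_row_last hp₀, add_zero] at hlog
  exact hlog

lemma bracket_mul_logCoeff_succ (hp₀ : (p₀.2 : ℕ) + 1 = blockDim s p₀.1) (u : Fin r → F[X])
    (n : ℕ) (p : Coord s) :
    -algebraMap F[X] (RatFunc F) (bracket F (n + 1)) * logCoeff F s u (n + 1) p₀ p =
      logCoeff F s u (n + 1) p₀ ⬝ᵥ (matN (RatFunc F) s).col p +
      logCoeff F s u n p₀ ⬝ᵥ
        (matE s fun e => algebraMap F[X] (RatFunc F) (u e) ^ Fintype.card F ^ n).col p := by
  have hrow : _ + _ ⬝ᵥ (matN (RatFunc F) s).col p + _ ⬝ᵥ (matE s _).col p = _ :=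
    congrFun (logCoeff_succ_row hp₀ u n) p
  simp only [Pi.smul_apply, smul_eq_mul] at hrow
  rw [bracket, map_sub, map_pow, RatFunc.algebraMap_X]
  linear_combination -hrow

lemma blockDim_le_weight (s : Fin r → ℕ) (l : Fin r) : blockDim s l ≤ weight s :=
  Finset.sum_le_sum_of_subset (Finset.subset_univ _)

variable (v : HeightOneSpectrum F[X])

lemma valuation_bracket (n : ℕ) :
    v.valuation (RatFunc F) (algebraMap F[X] (RatFunc F) (bracket F (n + 1))) =
      exp (-(if placeDegree v ∣ n + 1 then 1 else 0 : ℤ)) := by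
  rw [v.valuation_of_algebraMap, intValuation_eq_exp_neg_ordA v (bracket_ne_zero F n),
    ordA_bracket]

/-- Along a block, each column of `P_{n+1}` costs one division by `[n + 1]`. -/
lemma valuation_logCoeff_succ_le (hp₀ : (p₀.2 : ℕ) + 1 = blockDim s p₀.1) {u : Fin r → F[X]}
    {n : ℕ} {m : ℤ} (hm : ∀ p, v.valuation (RatFunc F) (logCoeff F s u n p₀ p) ≤ exp m)
    {l : Fin r} {k : ℕ} (hk : k < blockDim s l) :
    v.valuation (RatFunc F) (logCoeff F s u (n + 1) p₀ ⟨l, k, hk⟩) ≤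
      exp (m + (k + 1) * if placeDegree v ∣ n + 1 then 1 else 0) := by
  set ε : ℤ := if placeDegree v ∣ n + 1 then 1 else 0 with hε
  have hdiv {x y : RatFunc F} {b : ℤ}
      (hxy : -algebraMap F[X] (RatFunc F) (bracket F (n + 1)) * x = y)
      (hy : v.valuation (RatFunc F) y ≤ exp b) : v.valuation (RatFunc F) x ≤ exp (b + ε) := by
    rw [← hxy, map_mul, Valuation.map_neg, valuation_bracket, ← hε] at hy
    calc v.valuation (RatFunc F) x = exp ε * (exp (-ε) * v.valuation (RatFunc F) x) := by
          rw [← mul_assoc, ← exp_add, add_neg_cancel, exp_zero, one_mul]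
      _ ≤ exp ε * exp b := mul_le_mul_right hy _
      _ = exp (b + ε) := by rw [← exp_add, add_comm]
  induction k with
  | zero =>
    have hrow := bracket_mul_logCoeff_succ hp₀ u n ⟨l, 0, hk⟩
    rw [matN_col_zero hk, dotProduct_zero, zero_add] at hrow
    simpa using hdiv hrow ((valuation_dotProduct_le _ hm
      fun p => valuation_matE_le_one v u _ p _).trans_eq (mul_one (exp m)))
  | succ k ih =>
    have hrow := bracket_mul_logCoeff_succ hp₀ u n ⟨l, k + 1, hk⟩
    rw [matN_col_succ hk, matE_col_of_ne _ k.succ_ne_zero, dotProduct_zero, dotProduct_single_one,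
      add_zero] at hrow
    refine (hdiv hrow (ih (by omega))).trans_eq ?_
    push_cast
    ring_nf

/-- The denominators of the row `p₀` of `P_n` grow by at most `wt(𝔰)` each time `d` divides `n`,
as `[n]` is then divisible by `v` exactly once. -/
lemma valuation_logCoeff_le (hp₀ : (p₀.2 : ℕ) + 1 = blockDim s p₀.1) (u : Fin r → F[X]) (n : ℕ)
    (p : Coord s) :
    v.valuation (RatFunc F) (logCoeff F s u n p₀ p) ≤
      exp ((weight s * (n / placeDegree v) : ℕ) : ℤ) := by
  induction n generalizing p with
  | zero =>
    rw [logCoeff_zero, Matrix.one_apply]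
    split_ifs <;> simp
  | succ n ih =>
    obtain ⟨l, k, hk⟩ := p
    refine (valuation_logCoeff_succ_le v hp₀ ih hk).trans ?_
    have hkw : (k : ℤ) + 1 ≤ weight s := by exact_mod_cast hk.trans_le (blockDim_le_weight s l)
    rw [exp_le_exp, Nat.succ_div]
    split_ifs
    · push_cast
      linarith
    · simp

end LogRow

section Valued

variable {R : Type*} [Ring R] [Valued R ℤᵐ⁰]

lemma nonarchimedeanAddGroup_of_valued : NonarchimedeanAddGroup R where
  is_nonarchimedean U hU := by
    obtain ⟨γ, hγ⟩ := Valued.mem_nhds_zero.1 hU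
    exact ⟨⟨Valuation.ltAddSubgroup Valued.v.restrict γ, Valued.isOpen_ball R γ.1⟩, hγ⟩

lemma tendsto_zero_of_forall_eventually_valued_lt {α : Type*} {l : Filter α} {f : α → R}
    (h : ∀ k : ℤ, ∀ᶠ i in l, Valued.v (f i) < exp k) : Tendsto f l (𝓝 0) := by
  intro U hU
  obtain ⟨γ, hγ⟩ := Valued.mem_nhds_zero.1 hU
  have hne : MonoidWithZeroHom.ValueGroup₀.embedding γ.1 ≠ 0 := (_root_.map_ne_zero _).2 γ.ne_zero
  refine mem_map.2 ((h (log (MonoidWithZeroHom.ValueGroup₀.embedding γ.1))).mono fun i hi => hγ ?_)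
  rw [exp_log hne] at hi
  exact (Valuation.restrict_lt_iff_lt_embedding _).2 hi

lemma valued_tsum_le {α : Type*} {f : α → R} {b : ℤᵐ⁰} (h : ∀ i, Valued.v (f i) ≤ b) :
    Valued.v (∑' i, f i) ≤ b := by
  by_cases hf : Summable f
  · by_contra! hlt
    have hconst := Valued.locally_const (x := ∑' i, f i) (ne_of_gt (zero_le.trans_lt hlt))
    obtain ⟨S, hS⟩ := (hf.hasSum.eventually hconst).exists
    exact hlt.not_ge (hS ▸ Valued.v.map_sum_le fun i _ => h i)
  · rw [tsum_eq_zero_of_not_summable hf, map_zero]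
    exact zero_le

end Valued

section Completion

variable {F : Type*} [Field F] (v : HeightOneSpectrum F[X])

lemma valued_algebraMap (a : F[X]) :
    Valued.v (algebraMap F[X] (v.adicCompletion (RatFunc F)) a) = v.intValuation a :=
  (HeightOneSpectrum.valuedAdicCompletion_eq_valuation v a).trans (v.valuation_of_algebraMap a)

lemma valued_algebraMap_le_one (a : F[X]) :
    Valued.v (algebraMap F[X] (v.adicCompletion (RatFunc F)) a) ≤ 1 :=
  (valued_algebraMap v a).trans_le (v.intValuation_le_one a)

lemma valued_algebraMap_eq_one {a : F[X]} (ha : a ∉ v.asIdeal) :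
    Valued.v (algebraMap F[X] (v.adicCompletion (RatFunc F)) a) = 1 := by
  rwa [valued_algebraMap, v.intValuation_eq_one_iff]

variable {r : ℕ} (s : Fin r → ℕ)

/-- The `𝔽_q`-module of the points of `G_{𝔰,𝐮}` over `k_v` with coordinates in `𝔪_v`; the series
`log_G` converges there. -/
def maximalPoints : Submodule F (Coord s → v.adicCompletion (RatFunc F)) where
  carrier := {x | ∀ p, Valued.v (x p) < 1}
  add_mem' hx hy p := Valued.v.map_add_lt (hx p) (hy p)
  zero_mem' p := by rw [Pi.zero_apply, map_zero]; exact zero_lt_one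
  smul_mem' c x hx p := by
    rw [Pi.smul_apply, Algebra.smul_def, map_mul,
      IsScalarTower.algebraMap_apply F F[X] (v.adicCompletion (RatFunc F))]
    exact (mul_le_of_le_one_left' (valued_algebraMap_le_one v _)).trans_lt (hx p)

variable {v s}

lemma valued_le_exp_neg_one {a : v.adicCompletion (RatFunc F)} (ha : Valued.v a < 1) :
    Valued.v a ≤ exp (-1) :=
  (lt_mul_exp_iff_le exp_ne_zero).1 (ha.trans_eq (by rw [← exp_add]; rfl))

lemma mulVec_mem_maximalPoints (M : Matrix (Coord s) (Coord s) F[X])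
    {x : Coord s → v.adicCompletion (RatFunc F)} (hx : x ∈ maximalPoints v s) :
    (M.map (algebraMap F[X] (v.adicCompletion (RatFunc F)))).mulVec x ∈ maximalPoints v s :=
  fun p => Valued.v.map_sum_lt one_ne_zero fun p' _ => by
    rw [map_mul]
    exact (mul_le_of_le_one_left' (valued_algebraMap_le_one v _)).trans_lt (hx p')

lemma smul_add_matN_mulVec_mem_maximalPoints {x : Coord s → v.adicCompletion (RatFunc F)}
    (hx : x ∈ maximalPoints v s) :
    algebraMap F[X] (v.adicCompletion (RatFunc F)) X • x +
      (matN (v.adicCompletion (RatFunc F)) s).mulVec x ∈ maximalPoints v s := by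
  rw [← map_matN (algebraMap F[X] _)]
  refine add_mem (fun p => ?_) (mulVec_mem_maximalPoints _ hx)
  rw [Pi.smul_apply, smul_eq_mul, map_mul]
  exact (mul_le_of_le_one_left' (valued_algebraMap_le_one v _)).trans_lt (hx p)

variable [Fintype F] {u : Fin r → F[X]}

lemma matE_mulVec_pow_card_mem_maximalPoints {x : Coord s → v.adicCompletion (RatFunc F)}
    (hx : x ∈ maximalPoints v s) :
    (matE s (algebraMap F[X] (v.adicCompletion (RatFunc F)) ∘ u)).mulVec
      (fun p => x p ^ Fintype.card F) ∈ maximalPoints v s := by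
  rw [← map_matE]
  refine mulVec_mem_maximalPoints _ fun p => ?_
  rw [map_pow]
  exact pow_lt_one₀ zero_le (hx p) Fintype.card_ne_zero

lemma pointsRhoT_mem_maximalPoints {x : Coord s → v.adicCompletion (RatFunc F)}
    (hx : x ∈ maximalPoints v s) :
    pointsRhoT F (algebraMap F[X] _ X) s (algebraMap F[X] _ ∘ u) x ∈ maximalPoints v s :=
  add_mem (smul_add_matN_mulVec_mem_maximalPoints hx) (matE_mulVec_pow_card_mem_maximalPoints hx)

lemma aeval_pointsRhoT_mem_maximalPoints (a : F[X]) {x : Coord s → v.adicCompletion (RatFunc F)}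
    (hx : x ∈ maximalPoints v s) :
    aeval (pointsRhoT F (algebraMap F[X] _ X) s (algebraMap F[X] _ ∘ u)) a x ∈
      maximalPoints v s :=
  aeval_apply_smul_mem_of_le_comap hx a _ fun _ => pointsRhoT_mem_maximalPoints

end Completion

section LogTerms

variable {F K : Type*} [Field F] [Fintype F] [CommRing K] [Algebra (RatFunc F) K] {r : ℕ}
  {s : Fin r → ℕ} {u : Fin r → F[X]} {p₀ : Coord s}

lemma algebraMap_logCoeff_succ_row [Algebra F[X] K] [IsScalarTower F[X] (RatFunc F) K]
    (hp₀ : (p₀.2 : ℕ) + 1 = blockDim s p₀.1) (n : ℕ) :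
    Matrix.vecMul (algebraMap (RatFunc F) K ∘ logCoeff F s u (n + 1) p₀)
        (algebraMap F[X] K X ^ Fintype.card F ^ (n + 1) • 1 + matN K s) +
      Matrix.vecMul (algebraMap (RatFunc F) K ∘ logCoeff F s u n p₀)
        (matE s fun e => algebraMap F[X] K (u e) ^ Fintype.card F ^ n) =
    algebraMap F[X] K X • (algebraMap (RatFunc F) K ∘ logCoeff F s u (n + 1) p₀) := by
  funext p
  have hrow := congrArg (algebraMap (RatFunc F) K) (congrFun (logCoeff_succ_row hp₀ u n) p)
  simp only [Pi.add_apply, Pi.smul_apply, smul_eq_mul, map_add, map_mul, map_pow,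
    RingHom.map_vecMul, map_matN, map_matE, ← RatFunc.algebraMap_X] at hrow
  simp only [Function.comp_def, map_pow, ← IsScalarTower.algebraMap_apply] at hrow
  simpa only [Matrix.vecMul_add, Matrix.vecMul_smul, Matrix.vecMul_one, Pi.add_apply,
    Pi.smul_apply, smul_eq_mul, Function.comp_def] using hrow

variable [Algebra F K]

variable (s u) in
/-- The `i`-th term `P_i τ^i` of `log_G`, acting on the points of `G_{𝔰,𝐮}` over a `k`-algebra. -/
noncomputable def logTerm (i : ℕ) : (Coord s → K) →ₗ[F] Coord s → K :=
  ((logCoeff F s u i).map (algebraMap (RatFunc F) K)).mulVecLin.restrictScalars F ∘ₗ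
    (FiniteField.frobeniusAlgHom F K ^ i).toLinearMap.compLeft (Coord s)

lemma logTerm_apply (i : ℕ) (x : Coord s → K) :
    logTerm s u i x p₀ = (algebraMap (RatFunc F) K ∘ logCoeff F s u i p₀) ⬝ᵥ
      fun p => x p ^ Fintype.card F ^ i := by
  simp only [← frobeniusAlgHom_pow_apply]
  rfl

lemma logTerm_mulVec (i : ℕ) (M : Matrix (Coord s) (Coord s) K) (x : Coord s → K) :
    logTerm s u i (M.mulVec x) p₀ =
      Matrix.vecMul (algebraMap (RatFunc F) K ∘ logCoeff F s u i p₀)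
        (M.map (· ^ Fintype.card F ^ i)) ⬝ᵥ fun p => x p ^ Fintype.card F ^ i := by
  rw [logTerm_apply, ← Matrix.dotProduct_mulVec]
  congr 1
  funext p
  simp only [← frobeniusAlgHom_pow_apply]
  exact RingHom.map_mulVec (FiniteField.frobeniusAlgHom F K ^ i).toRingHom M x p

lemma logTerm_zero (x : Coord s → K) : logTerm s u 0 x p₀ = x p₀ := by
  simp [logTerm, logCoeff_zero]

variable [Algebra F[X] K]

lemma mul_logTerm_zero (hp₀ : (p₀.2 : ℕ) + 1 = blockDim s p₀.1) (x : Coord s → K) :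
    algebraMap F[X] K X * logTerm s u 0 x p₀ =
      logTerm s u 0 (algebraMap F[X] K X • x + (matN K s).mulVec x) p₀ := by
  have hN : (matN K s).mulVec x p₀ = 0 := by
    rw [Matrix.mulVec, matN_row_last hp₀, zero_dotProduct]
  rw [logTerm_zero, logTerm_zero, Pi.add_apply, hN, add_zero, Pi.smul_apply, smul_eq_mul]

variable [IsScalarTower F[X] (RatFunc F) K]

/-- The terms of degree `n + 1` in `log ∘ ρ_t = ∂ρ_t ∘ log`, with `ρ_t` split into its linear
part `θ + N` and `E τ`. -/
lemma mul_logTerm_succ (hp₀ : (p₀.2 : ℕ) + 1 = blockDim s p₀.1) (n : ℕ) (x : Coord s → K) :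
    algebraMap F[X] K X * logTerm s u (n + 1) x p₀ =
      logTerm s u (n + 1) (algebraMap F[X] K X • x + (matN K s).mulVec x) p₀ +
      logTerm s u n
        ((matE s (algebraMap F[X] K ∘ u)).mulVec fun p => x p ^ Fintype.card F) p₀ := by
  have hx : algebraMap F[X] K X • x + (matN K s).mulVec x =
      (algebraMap F[X] K X • (1 : Matrix (Coord s) (Coord s) K) + matN K s).mulVec x := by
    rw [Matrix.add_mulVec, Matrix.smul_mulVec, Matrix.one_mulVec]
  rw [hx, logTerm_mulVec, logTerm_mulVec, map_pow_card_pow_smul_one_add_matN,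
    map_pow_card_pow_matE]
  simp only [← pow_mul, ← pow_succ']
  rw [← add_dotProduct]
  simp only [Function.comp_apply]
  rw [algebraMap_logCoeff_succ_row hp₀, smul_dotProduct, smul_eq_mul, logTerm_apply]

end LogTerms

section LogSeries

variable {F : Type*} [Field F] [Fintype F] {v : HeightOneSpectrum F[X]} {r : ℕ} {s : Fin r → ℕ}
  {u : Fin r → F[X]} {p₀ : Coord s}

lemma logG_apply (x : Coord s → v.adicCompletion (RatFunc F)) :
    logG v s u x p₀ = ∑' i, logTerm s u i x p₀ := by
  simp only [logTerm_apply]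
  rfl

lemma valued_logTerm_le (hp₀ : (p₀.2 : ℕ) + 1 = blockDim s p₀.1)
    {x : Coord s → v.adicCompletion (RatFunc F)} (hx : x ∈ maximalPoints v s) (i : ℕ) :
    Valued.v (logTerm s u i x p₀) ≤
      exp ((weight s * (i / placeDegree v) : ℕ) - (Fintype.card F : ℤ) ^ i) := by
  rw [logTerm_apply, sub_eq_add_neg, exp_add]
  refine valuation_dotProduct_le _ (fun p => ?_) fun p => ?_
  · exact (HeightOneSpectrum.valuedAdicCompletion_eq_valuation' v _).trans_le
      (valuation_logCoeff_le v hp₀ u i p)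
  · rw [map_pow]
    refine (pow_le_pow_left' (valued_le_exp_neg_one (hx p)) _).trans_eq ?_
    rw [← exp_nsmul]
    simp

/-- The exponent is compared with `B_{wt(𝔰)+1,v}` to leave room for a term tending to infinity. -/
lemma summable_logTerm (hp₀ : (p₀.2 : ℕ) + 1 = blockDim s p₀.1)
    {x : Coord s → v.adicCompletion (RatFunc F)} (hx : x ∈ maximalPoints v s) :
    Summable fun i => logTerm s u i x p₀ := by
  have := nonarchimedeanAddGroup_of_valued (R := v.adicCompletion (RatFunc F))
  refine NonarchimedeanAddGroup.summable_of_tendsto_cofinite_zero ?_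
  rw [Nat.cofinite_eq_atTop]
  refine tendsto_zero_of_forall_eventually_valued_lt fun k => ?_
  filter_upwards [eventually_ge_atTop
    ((1 - k - boundB v (weight s + 1)).toNat * placeDegree v)] with i hi
  refine (valued_logTerm_le hp₀ hx i).trans_lt (exp_lt_exp.2 ?_)
  have hdiv := (Nat.le_div_iff_mul_le (placeDegree_pos v)).2 hi
  have hB := boundB_le_card_pow_sub v (weight s + 1) i
  rw [Nat.cast_mul, Nat.cast_add, Nat.cast_one] at hB
  rw [Nat.cast_mul]
  linarith [Int.self_le_toNat (1 - k - boundB v (weight s + 1)), Int.ofNat_le.2 hdiv]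

lemma valued_logG_le (hp₀ : (p₀.2 : ℕ) + 1 = blockDim s p₀.1)
    {x : Coord s → v.adicCompletion (RatFunc F)} (hx : x ∈ maximalPoints v s) :
    Valued.v (logG v s u x p₀) ≤ exp (-boundB v (weight s)) := by
  rw [logG_apply]
  refine valued_tsum_le fun i => (valued_logTerm_le hp₀ hx i).trans (exp_le_exp.2 ?_)
  linarith [boundB_le_card_pow_sub v (weight s) i]

lemma logG_add (hp₀ : (p₀.2 : ℕ) + 1 = blockDim s p₀.1)
    {x y : Coord s → v.adicCompletion (RatFunc F)} (hx : x ∈ maximalPoints v s)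
    (hy : y ∈ maximalPoints v s) :
    logG v s u (x + y) p₀ = logG v s u x p₀ + logG v s u y p₀ := by
  simp only [logG_apply, map_add, Pi.add_apply]
  exact (summable_logTerm hp₀ hx).tsum_add (summable_logTerm hp₀ hy)

lemma logG_smul (hp₀ : (p₀.2 : ℕ) + 1 = blockDim s p₀.1) (c : F)
    {x : Coord s → v.adicCompletion (RatFunc F)} (hx : x ∈ maximalPoints v s) :
    logG v s u (c • x) p₀ = c • logG v s u x p₀ := by
  simp only [logG_apply, map_smul, Pi.smul_apply]
  simp only [Algebra.smul_def]
  exact (summable_logTerm hp₀ hx).tsum_mul_left _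

lemma logG_pointsRhoT (hp₀ : (p₀.2 : ℕ) + 1 = blockDim s p₀.1)
    {x : Coord s → v.adicCompletion (RatFunc F)} (hx : x ∈ maximalPoints v s) :
    logG v s u (pointsRhoT F (algebraMap F[X] _ X) s (algebraMap F[X] _ ∘ u) x) p₀ =
      algebraMap F[X] _ X * logG v s u x p₀ := by
  have hy := smul_add_matN_mulVec_mem_maximalPoints hx
  have hz := matE_mulVec_pow_card_mem_maximalPoints (u := u) hx
  have hy_sum := summable_logTerm (u := u) hp₀ hy
  rw [pointsRhoT_apply, logG_add hp₀ hy hz, logG_apply, logG_apply, logG_apply,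
    ← (summable_logTerm hp₀ hx).tsum_mul_left,
    ((summable_logTerm hp₀ hx).mul_left _).tsum_eq_zero_add, hy_sum.tsum_eq_zero_add, add_assoc,
    ← ((summable_nat_add_iff 1).2 hy_sum).tsum_add (summable_logTerm hp₀ hz),
    mul_logTerm_zero hp₀]
  simp only [mul_logTerm_succ hp₀]

lemma logG_aeval_pointsRhoT (hp₀ : (p₀.2 : ℕ) + 1 = blockDim s p₀.1) (a : F[X])
    {x : Coord s → v.adicCompletion (RatFunc F)} (hx : x ∈ maximalPoints v s) :
    logG v s u (aeval (pointsRhoT F (algebraMap F[X] _ X) s (algebraMap F[X] _ ∘ u)) a x) p₀ =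
      algebraMap F[X] _ a * logG v s u x p₀ := by
  induction a using Polynomial.induction_on with
  | C c =>
    rw [aeval_C, Module.algebraMap_end_apply, logG_smul hp₀ c hx, Algebra.smul_def,
      IsScalarTower.algebraMap_apply F F[X] (v.adicCompletion (RatFunc F))]
    rfl
  | add a b ha hb =>
    rw [map_add, LinearMap.add_apply, logG_add hp₀ (aeval_pointsRhoT_mem_maximalPoints a hx)
      (aeval_pointsRhoT_mem_maximalPoints b hx), ha, hb, map_add, add_mul]
  | monomial n c ih =>
    rw [pow_succ', mul_left_comm, map_mul, Module.End.mul_apply, aeval_X,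
      logG_pointsRhoT hp₀ (aeval_pointsRhoT_mem_maximalPoints _ hx), ih, map_mul _ X, mul_assoc]

end LogSeries

section StarLog

variable {F : Type*} [Field F] [Fintype F] {v : HeightOneSpectrum F[X]} {r : ℕ} {s : Fin r → ℕ}
  {u : Fin r → F[X]} {a : F[X]}

lemma IsAdmissible.algebraMap_rho_mem (ha : IsAdmissible v s u a) :
    algebraMap F[X] _ ∘ rho s u a (specialPoint s u) ∈ maximalPoints v s :=
  ha.2

lemma logG_rho {p₀ : Coord s} (hp₀ : (p₀.2 : ℕ) + 1 = blockDim s p₀.1) (b : F[X])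
    {x : Coord s → F[X]} (hx : algebraMap F[X] _ ∘ x ∈ maximalPoints v s) :
    logG v s u (algebraMap F[X] _ ∘ rho s u b x) p₀ =
      algebraMap F[X] _ b * logG v s u (algebraMap F[X] _ ∘ x) p₀ :=
  (congrArg (logG v s u · p₀) (map_rho_apply
    (IsScalarTower.toAlgHom F F[X] (v.adicCompletion (RatFunc F))) s u b x)).trans
    (logG_aeval_pointsRhoT hp₀ b hx)

/-- With `b` admissible and prime to `v`, compare `b log(ρ_a 𝐯) = log(ρ_{ab} 𝐯) = a log(ρ_b 𝐯)`. -/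
lemma IsAdmissible.valued_logG_rho_le (ha : IsAdmissible v s u a) {p₀ : Coord s}
    (hp₀ : (p₀.2 : ℕ) + 1 = blockDim s p₀.1) :
    Valued.v (logG v s u (algebraMap F[X] _ ∘ rho s u a (specialPoint s u)) p₀) ≤
      Valued.v (algebraMap F[X] (v.adicCompletion (RatFunc F)) a) *
        exp (-boundB v (weight s)) := by
  obtain ⟨b, hb, hbv⟩ := exists_isAdmissible_notMem v s u
  have hcomm : algebraMap F[X] _ b *
        logG v s u (algebraMap F[X] _ ∘ rho s u a (specialPoint s u)) p₀ =
      algebraMap F[X] _ a *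
        logG v s u (algebraMap F[X] _ ∘ rho s u b (specialPoint s u)) p₀ := by
    rw [← logG_rho hp₀ b ha.algebraMap_rho_mem, ← logG_rho hp₀ a hb.algebraMap_rho_mem,
      ← Module.End.mul_apply, ← Module.End.mul_apply, ← map_mul, ← map_mul, mul_comm]
  have hval := congrArg Valued.v hcomm
  rw [map_mul, map_mul, valued_algebraMap_eq_one v hbv, one_mul] at hval
  rw [hval]
  gcongr
  exact valued_logG_le hp₀ hb.algebraMap_rho_mem

variable (v s u)

lemma valued_starLi_le : Valued.v (starLi v s u) ≤ exp (-boundB v (weight s)) := by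
  have hw : weight (s ∘ Fin.rev) = weight s := Equiv.sum_comp Fin.revPerm s
  rw [starLi, ← hw]
  have ha := (exists_isAdmissible v (s ∘ Fin.rev) (u ∘ Fin.rev)).choose_spec
  set a := (exists_isAdmissible v (s ∘ Fin.rev) (u ∘ Fin.rev)).choose
  have ha₀ : Valued.v (algebraMap F[X] (v.adicCompletion (RatFunc F)) a) ≠ 0 := by
    rw [valued_algebraMap]
    exact v.intValuation_ne_zero _ ha.1
  rw [map_mul, map_div₀, map_pow, Valuation.map_neg, map_one, one_pow]
  refine (mul_le_mul_right (Valued.v.map_sum_le fun p hp =>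
    ha.valued_logG_rho_le (Finset.mem_filter.1 hp).2.2) _).trans_eq ?_
  rw [← mul_assoc, one_div, inv_mul_cancel₀ ha₀, one_mul]

end StarLog

section MZV

lemma sum_map_fst_merge {R : Type*} [Mul R] (w : List Bool) (l : List (ℕ × R)) :
    ((merge w l).map Prod.fst).sum = (l.map Prod.fst).sum := by
  induction w, l using merge.induct with
  | case1 w x l ih => simp [merge, ih]
  | case2 w x y l ih => simp [merge, ih, add_assoc]
  | case3 w l hcomma hplus => rw [merge.eq_3 w l hcomma hplus]

lemma weight_eq_sum_ofFn {r : ℕ} (s : Fin r → ℕ) : weight s = (List.ofFn s).sum :=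
  List.sum_ofFn.symm

lemma weight_merge {R : Type*} [Mul R] {r : ℕ} (w : List Bool) (s : Fin r → ℕ) (u : Fin r → R) :
    weight (fun i => ((merge w (List.ofFn fun i => (s i, u i))).get i).1) = weight s := by
  have hsum := sum_map_fst_merge w (List.ofFn fun i => (s i, u i))
  rw [List.map_ofFn] at hsum
  rw [weight_eq_sum_ofFn, weight_eq_sum_ofFn]
  refine Eq.trans (congrArg List.sum ?_) hsum
  exact List.map_ofFn.symm.trans (congrArg _ (List.ofFn_get _))

lemma carlitzGammaIndex_ne_zero (F : Type*) [Field F] [Fintype F] {r : ℕ} (s : Fin r → ℕ) :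
    carlitzGammaIndex F s ≠ 0 :=
  Finset.prod_ne_zero_iff.2 fun _ _ => carlitzGammaSucc_ne_zero F _

variable {F : Type*} [Field F] [Fintype F] (v : HeightOneSpectrum F[X]) {r : ℕ} {s : Fin r → ℕ}

lemma valued_vadicMZV_le (s : Fin r → ℕ) : Valued.v (vadicMZV v s) ≤
    exp (ordA v (carlitzGammaIndex F s) - boundB v (weight s)) := by
  rw [vadicMZV, map_mul, map_inv₀, valued_algebraMap,
    intValuation_eq_exp_neg_ordA v (carlitzGammaIndex_ne_zero F s), ← exp_neg, neg_neg,
    sub_eq_add_neg, exp_add]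
  gcongr
  refine Valued.v.map_sum_le fun j _ => Valued.v.map_sum_le fun w _ => ?_
  dsimp only
  rw [map_mul, map_mul, map_pow, Valuation.map_neg, map_one, one_pow, mul_one,
    ← weight_merge (List.ofFn w) s fun i => (andersonThakur F (s i - 1)).coeff (j i)]
  exact (mul_le_of_le_one_left' (valued_algebraMap_le_one v _)).trans (valued_starLi_le v _ _)

lemma le_ordv_vadicMZV (hs : ∀ i, 0 < s i) :
    (((boundB v (weight s) : ℚ) - ((weight s : ℚ) - r - height s) / ((qv v : ℚ) - 1) : ℚ) :
      WithTop ℚ) ≤ ordv v (vadicMZV v s) := by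
  rw [ordv]
  split_ifs with hζ
  · exact le_top
  have hq : (0 : ℚ) < (qv v : ℚ) - 1 := sub_pos.2 (mod_cast one_lt_qv v)
  have hΓ : (ordA v (carlitzGammaIndex F s) : ℚ) ≤
      ((weight s : ℚ) - r - height s) / ((qv v : ℚ) - 1) := by
    rw [le_div_iff₀' hq]
    exact_mod_cast ordA_carlitzGammaIndex_le v hs
  have hlog := Int.cast_le (R := ℚ).2
    ((log_le_iff_le_exp ((_root_.map_ne_zero _).2 hζ)).2 (valued_vadicMZV_le v s))
  rw [Int.cast_sub] at hlog
  rw [WithTop.coe_le_coe, Int.cast_neg]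
  linarith

/-- If `𝔰 ≠ (1, …, 1)` then `wt(𝔰) - dep(𝔰) - ht(𝔰) < q_v - 1`, so `Γ_𝔰` is a `v`-adic unit. -/
lemma vadicMZV_mem_of_weight_le_qv (hs : ∀ i, 0 < s i) (hw : weight s ≤ qv v) :
    vadicMZV v s ∈ v.adicCompletionIntegers (RatFunc F) := by
  have hq := one_lt_qv v
  have hΓ := ordA_carlitzGammaIndex_le v hs
  have hdefect : (weight s : ℤ) - r - height s < qv v - 1 := by
    obtain hht | hht := (height s).eq_zero_or_pos
    · have hs₁ : ∀ i, s i = 1 := by simpa [height, Finset.filter_eq_empty_iff] using hht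
      have hwr : weight s = r := by simp [weight, hs₁]
      omega
    · have hr : height s ≤ r := (Finset.card_le_univ _).trans_eq (Fintype.card_fin r)
      omega
  have hΓ₀ : ordA v (carlitzGammaIndex F s) ≤ 0 := by
    by_contra! hpos
    nlinarith
  rw [HeightOneSpectrum.mem_adicCompletionIntegers, ← exp_zero]
  refine (valued_vadicMZV_le v s).trans (exp_le_exp.2 ?_)
  linarith [boundB_nonneg v hw]

end MZV

end VadicMZV

/-- For every index `𝔰 = (s_1, …, s_r)` of positive integers, `r ≥ 1`: the lower bound for
`ord_v(ζ_A(𝔰)_v)` at every finite place `v`, integrality if `q_v ≥ wt(𝔰)`, and hence integrality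
at all but finitely many `v`. -/
theorem theorem4p2 (F : Type*) [Field F] [Fintype F] {r : ℕ} (hr : 0 < r) (s : Fin r → ℕ)
    (hs : ∀ i, 0 < s i) :
    (∀ v : HeightOneSpectrum F[X],
      (((VadicMZV.boundB v (VadicMZV.weight s) : ℚ) -
        ((VadicMZV.weight s : ℚ) - r - VadicMZV.height s) / ((VadicMZV.qv v : ℚ) - 1) : ℚ) :
          WithTop ℚ) ≤ VadicMZV.ordv v (VadicMZV.vadicMZV v s)) ∧
    (∀ v : HeightOneSpectrum F[X], VadicMZV.weight s ≤ VadicMZV.qv v →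
      VadicMZV.vadicMZV v s ∈ v.adicCompletionIntegers (RatFunc F)) ∧
    {v : HeightOneSpectrum F[X] |
      VadicMZV.vadicMZV v s ∉ v.adicCompletionIntegers (RatFunc F)}.Finite :=
  ⟨fun v => VadicMZV.le_ordv_vadicMZV v hs,
    fun v hv => VadicMZV.vadicMZV_mem_of_weight_le_qv v hs hv,
    (VadicMZV.finite_setOf_qv_lt (VadicMZV.weight s)).subset fun v hv =>
      not_le.1 fun h => hv (VadicMZV.vadicMZV_mem_of_weight_le_qv v hs h)⟩
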